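/- There is an algorithm that decides in time $O(|G|^{16})$, given a finite simple graph $G$ and vertices $u,v\in V(G)$, whether $G$ has an induced $uv$-path whose length (number of edges) is greater than the distance $d_G(u,v)$, the number of edges of a shortest $uv$-path ($d_G(u,v)=\infty$ if there is no $uv$-path). Here $|G|$ is the number $n$ of vertices of $G$, and an algorithm is a program for a word RAM, the same program for all inputs. Precisely: there are a program and constants $C,k$ such that, for all $n\ge 1$, every graph $G$ with vertex set $\{0,\dots,n-1\}$ and all $u,v\in V(G)$, when the program is started with $n,u,v$ in its first three registers and the adjacency matrix of $G$ in memory, and all other registers and cells zero, it halts after at most $C n^{16}$ steps with $1$ in its first register if such a path exists and $0$ otherwise, using only words of $O(\log n)$ bits (numbers less than $C n^{k}$). The steps are: setting a register to a constant, addition, truncated subtraction and multiplication of registers, reading or writing the memory cell whose address is in a register, a null operation, and testing whether a register is zero in a conditional or a while loop. -/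

import Mathlib

/-- A walk is an induced path if it is a path and the subgraph it traces is an induced subgraph. -/
def SimpleGraph.Walk.IsInducedPath {V : Type*} {G : SimpleGraph V} {u v : V}
    (p : G.Walk u v) : Prop :=
  p.IsPath ∧ p.toSubgraph.IsInduced

/-- `G` has a `uv`-NSP: an induced `uv`-path with more edges than the `G`-distance of `u` and `v`
(the distance is `⊤` if there is no `uv`-path). -/
def SimpleGraph.HasNSP {V : Type*} (G : SimpleGraph V) (u v : V) : Prop :=
  ∃ p : G.Walk u v, p.IsInducedPath ∧ G.edist u v < (p.length : ℕ∞)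

namespace WordRAM

/-- The state of a random-access machine: numbered registers, and an array of memory cells that are
addressed by the contents of registers. -/
structure State where
  reg : ℕ → ℕ
  mem : ℕ → ℕ

/-- Write `a` into register `z`. -/
def State.setReg (s : State) (z a : ℕ) : State :=
  { s with reg := Function.update s.reg z a }

/-- Write `a` into the memory cell with address `i`. -/
def State.setMem (s : State) (i a : ℕ) : State :=
  { s with mem := Function.update s.mem i a }

/-- Programs of the random-access machine, with structured control flow. The numbers `x y z` name
registers. -/
inductive Prog where
  /-- do nothing -/
  | skip : Prog
  /-- `z := c` -/
  | const (z c : ℕ) : Prog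
  /-- `z := x + y` -/
  | add (z x y : ℕ) : Prog
  /-- `z := max (x - y) 0` -/
  | sub (z x y : ℕ) : Prog
  /-- `z := x * y` -/
  | mul (z x y : ℕ) : Prog
  /-- `z := mem[x]` -/
  | load (z x : ℕ) : Prog
  /-- `mem[x] := y` -/
  | store (x y : ℕ) : Prog
  /-- first `P`, then `Q` -/
  | seq (P Q : Prog) : Prog
  /-- if `x ≠ 0` then `P` else `Q` -/
  | cond (x : ℕ) (P Q : Prog) : Prog
  /-- while `x ≠ 0` do `P` -/
  | loop (x : ℕ) (P : Prog) : Prog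

/-- `Exec W P s t s'`: started in the state `s`, the program `P` halts in the state `s'` after
exactly `t` steps, on a machine whose words hold the numbers less than `W`. Every elementary
instruction and every test of a condition takes one step. An instruction whose result would not fit
into a word cannot be executed; the only instructions that can produce a number that is larger than
all numbers present before are `const`, `add` and `mul`, so only these carry the check. -/
inductive Exec (W : ℕ) : Prog → State → ℕ → State → Prop where
  | skip (s : State) : Exec W .skip s 1 s
  | const (s : State) (z c : ℕ) (h : c < W) :
      Exec W (.const z c) s 1 (s.setReg z c)
  | add (s : State) (z x y : ℕ) (h : s.reg x + s.reg y < W) :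
      Exec W (.add z x y) s 1 (s.setReg z (s.reg x + s.reg y))
  | sub (s : State) (z x y : ℕ) :
      Exec W (.sub z x y) s 1 (s.setReg z (s.reg x - s.reg y))
  | mul (s : State) (z x y : ℕ) (h : s.reg x * s.reg y < W) :
      Exec W (.mul z x y) s 1 (s.setReg z (s.reg x * s.reg y))
  | load (s : State) (z x : ℕ) :
      Exec W (.load z x) s 1 (s.setReg z (s.mem (s.reg x)))
  | store (s : State) (x y : ℕ) :
      Exec W (.store x y) s 1 (s.setMem (s.reg x) (s.reg y))
  | seq {P Q : Prog} {s s₁ s₂ : State} {t₁ t₂ : ℕ}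
      (h₁ : Exec W P s t₁ s₁) (h₂ : Exec W Q s₁ t₂ s₂) :
      Exec W (.seq P Q) s (t₁ + t₂) s₂
  | cond_true {x : ℕ} {P Q : Prog} {s s₁ : State} {t : ℕ}
      (hx : s.reg x ≠ 0) (h : Exec W P s t s₁) :
      Exec W (.cond x P Q) s (t + 1) s₁
  | cond_false {x : ℕ} {P Q : Prog} {s s₁ : State} {t : ℕ}
      (hx : s.reg x = 0) (h : Exec W Q s t s₁) :
      Exec W (.cond x P Q) s (t + 1) s₁
  | loop_done {x : ℕ} {P : Prog} {s : State} (hx : s.reg x = 0) :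
      Exec W (.loop x P) s 1 s
  | loop_next {x : ℕ} {P : Prog} {s s₁ s₂ : State} {t₁ t₂ : ℕ}
      (hx : s.reg x ≠ 0) (h₁ : Exec W P s t₁ s₁) (h₂ : Exec W (.loop x P) s₁ t₂ s₂) :
      Exec W (.loop x P) s (t₁ + t₂ + 1) s₂

open Classical in
/-- The initial state for the input `(G, u, v)`, where `G` has the vertices `0, …, n - 1`: registers
`0, 1, 2` hold `n, u, v`; the memory holds the adjacency matrix of `G` row by row, from address `0`
on; everything else is zero. -/
noncomputable def inputState {n : ℕ} (G : SimpleGraph (Fin n)) (u v : Fin n) : State where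
  reg := fun r => if r = 0 then n else if r = 1 then (u : ℕ) else if r = 2 then (v : ℕ) else 0
  mem := fun a => if ∃ i j : Fin n, a = n * (i : ℕ) + (j : ℕ) ∧ G.Adj i j then 1 else 0

end WordRAM

/-! Let d be the distance of u and v, and call an induced uv-path with more than d edges an NSP. Two
facts carry the proof.

First, if connected sets X ∋ u and Y ∋ v with v ∉ X are joined by a single edge ac, then X ∪ Y
contains an induced uv-path, and it passes through ac (`exists_isInducedPath_of_cut`). Its length is
at least d(u,a) + 1 + d(c,v), so it is an NSP unless ac lies on a geodesic from u to v.

Second, in a shortest NSP p_0 … p_m let a = p_i be the last vertex with i + d(p_i,v) ≤ d, let b =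
p_k be the first with d(u,p_k) + m - k ≤ d, and let b' be the successor of b (or v if b = v). The
parts up to a and from b on are geodesic, and i < k. Consider any geodesic r from u to a and any
path q from b' to v that moves away from u in each step, such that r and q are disjoint with no edge
between them and r avoids b and its neighbours except possibly at a. Then no vertex of r before a
equals or is adjacent to a vertex of the path strictly between a and b (`not_touching`, by repeated
use of the first fact).

Hence outer and middle parts can be searched for independently. For all a, b, b', the pairs (r, q)
are explored level by level as walks on pairs of vertices (`PairStep`); vertices touching some r of
such a pair are forbidden (`Blocked`); and b must be reachable from a neighbour c of a in what
remains (`Link`), where ac is on no geodesic. The second fact shows that this succeeds if there is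
an NSP, the first that success yields one: `hasNSP_iff_hasDetour`.

Each relation involved has at most five arguments and is the least fixed point of a rule with at
most eight free variables. Making n^5 sweeps over n^8 valuations computes it, so n^13 steps suffice
up to a constant. -/

namespace SimpleGraph

/-! ### Walks inside vertex sets and induced paths through a cut edge. -/

variable {V : Type*} {G : SimpleGraph V} {u v a c x y z : V} {S T X Y : Set V} {k l : ℕ}

/-- There is a walk from `x` to `y` inside `S` of length at most `l`. -/
def WalkIn (G : SimpleGraph V) (S : Set V) (x y : V) (l : ℕ) : Prop :=
  ∃ w : G.Walk x y, w.length ≤ l ∧ ∀ z ∈ w.support, z ∈ S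

namespace WalkIn

theorem refl (h : x ∈ S) : G.WalkIn S x x 0 := ⟨.nil, by simp, by simpa using h⟩

theorem single (hx : x ∈ S) (hy : y ∈ S) (h : G.Adj x y) : G.WalkIn S x y 1 :=
  ⟨.cons h .nil, by simp, by simp [hx, hy]⟩

theorem trans (h : G.WalkIn S x y k) (h' : G.WalkIn S y z l) : G.WalkIn S x z (k + l) := by
  obtain ⟨w, hw, hs⟩ := h
  obtain ⟨w', hw', hs'⟩ := h'
  refine ⟨w.append w', by simp; omega, fun z hz => ?_⟩
  rw [Walk.mem_support_append_iff] at hz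
  exact hz.elim (hs z) (hs' z)

theorem symm (h : G.WalkIn S x y k) : G.WalkIn S y x k := by
  obtain ⟨w, hw, hs⟩ := h
  exact ⟨w.reverse, by simpa using hw, by simpa using hs⟩

theorem mono (h : G.WalkIn S x y k) (hS : S ⊆ T) (hk : k ≤ l) : G.WalkIn T x y l := by
  obtain ⟨w, hw, hs⟩ := h
  exact ⟨w, hw.trans hk, fun z hz => hS (hs z hz)⟩

theorem of_seq {f : ℕ → V} {i j : ℕ} (hij : i ≤ j) (hf : ∀ s, i ≤ s → s < j → G.Adj (f s) (f (s + 1)))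
    (hS : ∀ s, i ≤ s → s ≤ j → f s ∈ S) : G.WalkIn S (f i) (f j) (j - i) := by
  induction j, hij using Nat.le_induction with
  | base => simpa using refl (hS i le_rfl le_rfl)
  | succ j hij ih =>
    have h1 := ih (fun s h h' => hf s h (by omega)) (fun s h h' => hS s h (by omega))
    exact (h1.trans (single (hS j hij (by omega)) (hS _ (by omega) le_rfl)
      (hf j hij (by omega)))).mono subset_rfl (by omega)

end WalkIn

theorem Walk.IsInducedPath.getVert_inj {p : G.Walk u v} (hp : p.IsInducedPath) {i j : ℕ}
    (hi : i ≤ p.length) (hj : j ≤ p.length) (h : p.getVert i = p.getVert j) : i = j :=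
  hp.1.getVert_injOn hi hj h

theorem Walk.IsInducedPath.getVert_adj {p : G.Walk u v} (hp : p.IsInducedPath) {i j : ℕ}
    (hi : i ≤ p.length) (hj : j ≤ p.length) (h : G.Adj (p.getVert i) (p.getVert j)) :
    j = i + 1 ∨ i = j + 1 := by
  have := hp.2 (by simp [Walk.getVert_mem_support]) (by simp [Walk.getVert_mem_support]) h
  rw [Walk.toSubgraph_adj_iff] at this
  obtain ⟨k, hk, hkl⟩ := this
  rw [Sym2.eq_iff] at hk
  rcases hk with ⟨h1, h2⟩ | ⟨h1, h2⟩
  · have e1 := hp.getVert_inj hkl.le hi h1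
    have e2 := hp.getVert_inj (by omega) hj h2
    omega
  · have e1 := hp.getVert_inj hkl.le hj h1
    have e2 := hp.getVert_inj (by omega) hi h2
    omega

/-- A shortest walk inside a set of vertices is an induced path. -/
theorem WalkIn.exists_isInducedPath (h : G.WalkIn S u v l) :
    ∃ p : G.Walk u v, p.IsInducedPath ∧ p.length ≤ l ∧ ∀ z ∈ p.support, z ∈ S := by
  classical
  have hex : ∃ k, G.WalkIn S u v k := ⟨l, h⟩
  obtain ⟨w, hw, hs⟩ := Nat.find_spec hex
  have hmin : ∀ k, G.WalkIn S u v k → Nat.find hex ≤ k := fun k hk => Nat.find_min' hex hk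
  set m := Nat.find hex
  have hbs : ∀ z ∈ w.bypass.support, z ∈ S := fun z hz => hs z (w.support_bypass_subset_support hz)
  have hbl : w.bypass.length ≤ m := (w.length_bypass_le_length).trans hw
  have hm : m ≤ w.bypass.length := hmin _ ⟨_, le_rfl, hbs⟩
  refine ⟨w.bypass, ⟨w.bypass_isPath, ?_⟩, hbl.trans (hmin l h), hbs⟩
  set p := w.bypass
  -- A chord from position `i` to position `j` would give a walk in `S` of length `i + 1 + (p.length
  -- - j)`, against minimality.
  have key : ∀ i j, i < j → j ≤ p.length → G.Adj (p.getVert i) (p.getVert j) → j = i + 1 := by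
    intro i j hij hj hadj
    have hmem : ∀ s, p.getVert s ∈ S := fun s => hbs _ (p.getVert_mem_support s)
    have h1 := WalkIn.of_seq (G := G) (S := S) (f := p.getVert) (Nat.zero_le i)
      (fun s _ h => p.adj_getVert_succ (by omega)) (fun s _ _ => hmem s)
    have h2 := WalkIn.of_seq (G := G) (S := S) (f := p.getVert) hj
      (fun s _ h => p.adj_getVert_succ (by omega)) (fun s _ _ => hmem s)
    have h3 := (h1.trans (WalkIn.single (hmem i) (hmem j) hadj)).trans h2
    rw [Walk.getVert_zero, Walk.getVert_length] at h3
    have := hmin _ h3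
    omega
  intro x hx y hy hxy
  rw [Walk.mem_verts_toSubgraph] at hx hy
  obtain ⟨i, rfl, hi⟩ := Walk.mem_support_iff_exists_getVert.1 hx
  obtain ⟨j, rfl, hj⟩ := Walk.mem_support_iff_exists_getVert.1 hy
  rcases lt_trichotomy i j with hij | rfl | hij
  · obtain rfl := key i j hij hj hxy
    exact p.toSubgraph_adj_getVert (by omega)
  · exact (G.loopless.irrefl _ hxy).elim
  · obtain rfl := key j i hij hi hxy.symm
    exact (p.toSubgraph_adj_getVert (by omega)).symm

/-- The walk has to leave `X`, and at its first exit it can only use the edge `ac`. -/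
theorem Walk.dist_add_dist_le_length_of_cut
    (hv : v ∉ X) (hcross : ∀ x ∈ X, ∀ y ∈ Y, G.Adj x y → x = a ∧ y = c)
    (p : G.Walk x v) (hx : x ∈ X) (hp : ∀ z ∈ p.support, z ∈ X ∪ Y) (hr : G.Reachable x a) :
    G.dist x a + 1 + G.dist c v ≤ p.length := by
  induction p with
  | nil => exact (hv hx).elim
  | @cons x y v h p ih =>
    simp only [Walk.length_cons]
    by_cases hy : y ∈ X
    · have hya : G.Reachable y a := h.symm.reachable.trans hr
      have := ih hv hy (fun z hz => hp z (by simp [hz])) hya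
      have h1 := h.reachable.dist_triangle_left a
      rw [dist_eq_one_iff_adj.2 h] at h1
      omega
    · have hyY : y ∈ Y := (hp y (by simp)).resolve_left hy
      obtain ⟨rfl, rfl⟩ := hcross _ hx _ hyY h
      have := dist_le p
      simp only [dist_self]
      omega

/-- Two connected sets joined by a single edge `ac` contain an induced path through this edge. -/
theorem exists_isInducedPath_of_cut (h₁ : G.WalkIn X u a k) (h₂ : G.WalkIn Y c v l)
    (hac : G.Adj a c) (hv : v ∉ X) (hcross : ∀ x ∈ X, ∀ y ∈ Y, G.Adj x y → x = a ∧ y = c) :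
    ∃ p : G.Walk u v, p.IsInducedPath ∧ p.length ≤ k + 1 + l ∧
      G.dist u a + 1 + G.dist c v ≤ p.length := by
  have hr : G.Reachable u a := ⟨h₁.choose⟩
  have hu : u ∈ X := h₁.choose_spec.2 _ (by simp)
  have ha : a ∈ X := h₁.choose_spec.2 _ (by simp)
  have hc : c ∈ Y := h₂.choose_spec.2 _ (by simp)
  have h := ((h₁.mono Set.subset_union_left le_rfl).trans
    (WalkIn.single (Or.inl ha) (Or.inr hc) hac)).trans (h₂.mono Set.subset_union_right le_rfl)
  obtain ⟨p, hp, hl, hs⟩ := h.exists_isInducedPath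
  exact ⟨p, hp, hl, p.dist_add_dist_le_length_of_cut hv hcross hu hs hr⟩

theorem Reachable.exists_seq (h : G.Reachable u x) : ∃ f : ℕ → V, f 0 = u ∧ f (G.dist u x) = x ∧
    (∀ s < G.dist u x, G.Adj (f s) (f (s + 1))) ∧ ∀ s ≤ G.dist u x, G.dist u (f s) = s := by
  obtain ⟨w, hw⟩ := h.exists_walk_length_eq_dist
  refine ⟨w.getVert, by simp, by rw [← hw]; simp, fun s hs => w.adj_getVert_succ (by omega), ?_⟩
  intro s hs
  have h1 := dist_le (w.take s)
  have h2 := dist_le (w.drop s)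
  have hr : G.Reachable u (w.getVert s) := ⟨w.take s⟩
  have h3 := hr.dist_triangle_left x
  simp only [Walk.take_length, Walk.drop_length] at h1 h2
  omega

theorem dist_le_dist_add_sub {f : ℕ → V} {i j : ℕ} (hij : i ≤ j)
    (hf : ∀ s, i ≤ s → s < j → G.Adj (f s) (f (s + 1))) (hr : G.Reachable u (f i)) :
    G.Reachable u (f j) ∧ G.dist u (f j) ≤ G.dist u (f i) + (j - i) := by
  obtain ⟨w, hw, -⟩ := WalkIn.of_seq (S := Set.univ) hij hf (fun _ _ _ => trivial)
  have h1 := hr.dist_triangle_left (f j)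
  have h2 := dist_le w
  exact ⟨hr.trans ⟨w⟩, by omega⟩

end SimpleGraph

/-! ### Shortest NSPs. -/

namespace SimpleGraph

variable {V : Type*} {G : SimpleGraph V} {u v : V}

/-- `p 0, …, p m` is an induced `uv`-path of minimum length among those that are longer than the
distance of `u` and `v`. -/
structure IsShortestNSP (G : SimpleGraph V) (u v : V) (p : ℕ → V) (m : ℕ) : Prop where
  zero : p 0 = u
  last : p m = v
  inj : ∀ s t, s ≤ m → t ≤ m → p s = p t → s = t
  adj : ∀ s < m, G.Adj (p s) (p (s + 1))
  ind : ∀ s t, s ≤ m → t ≤ m → G.Adj (p s) (p t) → t = s + 1 ∨ s = t + 1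
  lt : G.dist u v < m
  minimal : ∀ w : G.Walk u v, w.IsInducedPath → G.dist u v < w.length → m ≤ w.length

namespace IsShortestNSP

variable {p : ℕ → V} {m i k : ℕ} (hP : G.IsShortestNSP u v p m)
include hP

theorem walkIn {S : Set V} {s t : ℕ} (hst : s ≤ t) (ht : t ≤ m)
    (h : ∀ j, s ≤ j → j ≤ t → p j ∈ S) : G.WalkIn S (p s) (p t) (t - s) :=
  WalkIn.of_seq hst (fun _ _ _ => hP.adj _ (by omega)) h

theorem reachable_to {s : ℕ} (hs : s ≤ m) : G.Reachable (p s) v := by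
  obtain ⟨w, -⟩ := hP.walkIn (S := Set.univ) hs le_rfl (fun _ _ _ => trivial)
  rw [hP.last] at w
  exact ⟨w⟩

theorem reachable_from {s : ℕ} (hs : s ≤ m) : G.Reachable u (p s) := by
  obtain ⟨w, -⟩ := hP.walkIn (S := Set.univ) (Nat.zero_le s) hs (fun _ _ _ => trivial)
  rw [hP.zero] at w
  exact ⟨w⟩

theorem dist_le_add {s : ℕ} (hs : s ≤ m) : G.dist u v ≤ G.dist u (p s) + G.dist (p s) v :=
  (hP.reachable_from hs).dist_triangle_left v

theorem dist_to_le {s : ℕ} (hs : s ≤ m) : G.dist (p s) v ≤ m - s := by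
  have h := hP.walkIn (S := Set.univ) hs le_rfl (fun _ _ _ => trivial)
  rw [hP.last] at h
  obtain ⟨w, hw, -⟩ := h
  exact (dist_le w).trans hw

theorem dist_from_le {s : ℕ} (hs : s ≤ m) : G.dist u (p s) ≤ s := by
  have h := hP.walkIn (S := Set.univ) (Nat.zero_le s) hs (fun _ _ _ => trivial)
  rw [hP.zero] at h
  obtain ⟨w, hw, -⟩ := h
  exact (dist_le w).trans hw

/-- This is how minimality of `m` is used: the induced path through `ac` has fewer than `m` edges,
so it cannot be longer than the distance of `u` and `v`. -/
theorem dist_add_dist_le {X Y : Set V} {a c : V} {l l' : ℕ} (h₁ : G.WalkIn X u a l)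
    (h₂ : G.WalkIn Y c v l') (hac : G.Adj a c) (hv : v ∉ X)
    (hcross : ∀ x ∈ X, ∀ y ∈ Y, G.Adj x y → x = a ∧ y = c) (hl : l + 1 + l' < m) :
    G.dist u a + 1 + G.dist c v ≤ G.dist u v := by
  obtain ⟨w, hw, hw1, hw2⟩ := exists_isInducedPath_of_cut h₁ h₂ hac hv hcross
  by_contra hlt
  have := hP.minimal w hw (by omega)
  omega

/-- The hypothesis leaves no slack in the triangle inequality at `p t`, so the upper bounds obtained
by walking along the path are attained. -/
theorem dist_suffix (hk : G.dist u (p k) + (m - k) ≤ G.dist u v) {t : ℕ} (hkt : k ≤ t)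
    (htm : t ≤ m) : G.dist u (p t) + m = G.dist u v + t ∧ G.dist (p t) v = m - t := by
  have h1 := (dist_le_dist_add_sub hkt (fun s _ h => hP.adj s (by omega))
    (hP.reachable_from (hkt.trans htm))).2
  have h2 := hP.dist_le_add htm
  have h3 := hP.dist_to_le htm
  omega

theorem dist_prefix (hi : i + G.dist (p i) v ≤ G.dist u v) (him : i ≤ m) {s : ℕ} (hs : s ≤ i) :
    G.dist u (p s) = s := by
  have h1 := (dist_le_dist_add_sub hs (fun s _ h => hP.adj s (by omega))
    (hP.reachable_from (hs.trans him))).2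
  have h2 := hP.dist_le_add him
  have h3 := hP.dist_from_le (hs.trans him)
  omega

/-- The middle part of a shortest NSP has no vertex equal or adjacent to an inner vertex of a
geodesic that may replace its initial part. -/
theorem not_touching {r q : ℕ → V} {B : ℕ}
    (hk : G.dist u (p k) + (m - k) ≤ G.dist u v)
    (hkmin : ∀ k' < k, G.dist u v < G.dist u (p k') + (m - k'))
    (hkm : k ≤ m)
    (hr0 : r 0 = u) (hradj : ∀ s < i, G.Adj (r s) (r (s + 1)))
    (hrd : ∀ s ≤ i, G.dist u (r s) = s)
    (hB : G.dist u (p (min (k + 1) m)) = B) (hqB : q B = p (min (k + 1) m))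
    (hqv : q (G.dist u v) = v)
    (hqadj : ∀ t, B ≤ t → t < G.dist u v → G.Adj (q t) (q (t + 1)))
    (hcross : ∀ s ≤ i, ∀ t, B ≤ t → t ≤ G.dist u v → r s ≠ q t ∧ ¬ G.Adj (r s) (q t))
    (hrb : ∀ s < i, r s ≠ p k ∧ ¬ G.Adj (r s) (p k)) :
    ∀ j, i < j → j < k → ∀ s < i, p j ≠ r s ∧ ¬ G.Adj (p j) (r s) := by
  by_contra! hcon
  have htouch : ∃ j, i < j ∧ j < k ∧ ∃ s < i, G.Adj (p j) (r s) := by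
    obtain ⟨j, hij, hjk, s, hs, h⟩ := hcon
    by_cases he : p j = r s
    · rcases s with _ | s
      · rw [hr0, ← hP.zero] at he
        have := hP.inj _ _ (by omega) (by omega) he
        omega
      · exact ⟨j, hij, hjk, s, by omega, he ▸ (hradj s (by omega)).symm⟩
    · exact ⟨j, hij, hjk, s, hs, h he⟩
  clear hcon
  -- With `j` maximal and then `s` minimal, the only edge between `r 0, …, r s` and `p j, …, p k` is
  -- the one joining `r s` and `p j`.
  obtain ⟨j, ⟨hij, hjk, htj⟩, hjmax⟩ : ∃ j, (i < j ∧ j < k ∧ ∃ s < i, G.Adj (p j) (r s)) ∧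
      ∀ j', j < j' → ¬ (i < j' ∧ j' < k ∧ ∃ s < i, G.Adj (p j') (r s)) := by
    classical
    obtain ⟨j0, hj0⟩ := htouch
    let Q := fun j => i < j ∧ j < k ∧ ∃ s < i, G.Adj (p j) (r s)
    refine ⟨Nat.findGreatest Q k, Nat.findGreatest_spec (P := Q) (m := j0) (by omega) hj0, ?_⟩
    intro j' hj' hQ
    exact Nat.findGreatest_is_greatest hj' (by omega) hQ
  replace hjmax : ∀ j', j < j' → j' < k → ∀ s < i, ¬ G.Adj (p j') (r s) := by
    intro j' h h' s hs hadj
    exact hjmax j' h ⟨by omega, h', s, hs, hadj⟩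
  obtain ⟨s, hsi, hjs, hsmin⟩ : ∃ s, s < i ∧ G.Adj (p j) (r s) ∧ ∀ s' < s, ¬ G.Adj (p j) (r s') := by
    classical
    have := Nat.find_spec htj
    exact ⟨Nat.find htj, this.1, this.2, fun s' hs' h =>
      Nat.find_min htj hs' ⟨by omega, h⟩⟩
  set d := G.dist u v with hd
  have hrwalk : ∀ {S : Set V} {s t : ℕ}, s ≤ t → t ≤ i → (∀ j, s ≤ j → j ≤ t → r j ∈ S) →
      G.WalkIn S (r s) (r t) (t - s) := fun hst ht h =>
    WalkIn.of_seq hst (fun _ _ _ => hradj _ (by omega)) h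
  have hKm : min (k + 1) m ≤ m := min_le_right _ _
  have hkK : k ≤ min (k + 1) m := by omega
  have hBm : B + m = d + min (k + 1) m := by
    rw [← hB]; exact (hP.dist_suffix hk hkK hKm).1
  have hrv : ∀ s ≤ i, r s ≠ v := fun s hs => hqv ▸ (hcross s hs d (by omega) le_rfl).1
  -- the distance of `p j` to `v`
  have h1 : s + 1 + G.dist (p j) v ≤ d := by
    have hX : G.WalkIn {x | ∃ s' ≤ s, x = r s'} u (r s) s := by
      have := hrwalk (S := {x | ∃ s' ≤ s, x = r s'}) (Nat.zero_le s) hsi.le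
        (fun j _ h => ⟨j, h, rfl⟩)
      rwa [hr0] at this
    have hY : G.WalkIn {y | (∃ j', j ≤ j' ∧ j' ≤ min (k + 1) m ∧ y = p j') ∨
        ∃ t, B ≤ t ∧ t ≤ d ∧ y = q t} (p j) v (m - j) := by
      have e1 := hP.walkIn (S := {y | (∃ j', j ≤ j' ∧ j' ≤ min (k + 1) m ∧ y = p j') ∨
        ∃ t, B ≤ t ∧ t ≤ d ∧ y = q t}) (s := j) (t := min (k + 1) m) (by omega) hKm
        (fun j' h h' => Or.inl ⟨j', h, h', rfl⟩)
      have e2 := WalkIn.of_seq (G := G) (S := {y | (∃ j', j ≤ j' ∧ j' ≤ min (k + 1) m ∧ y = p j') ∨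
        ∃ t, B ≤ t ∧ t ≤ d ∧ y = q t}) (f := q) (i := B) (j := d) (by omega) hqadj
        (fun t h h' => Or.inr ⟨t, h, h', rfl⟩)
      rw [hqB, hqv] at e2
      exact (e1.trans e2).mono subset_rfl (by omega)
    -- The connecting walk has `s + 1 + (m - j)` edges, fewer than `m` because `s < i < j`.
    have := hP.dist_add_dist_le hX hY hjs.symm ?_ ?_ (by omega)
    · rwa [hrd s hsi.le] at this
    · rintro ⟨s', hs', h⟩
      exact hrv s' (by omega) h.symm
    · rintro x ⟨s', hs', rfl⟩ y (⟨j', hj', hjK, rfl⟩ | ⟨t, ht, htd, rfl⟩) hxy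
      · rcases hj'.eq_or_lt with rfl | hlt
        · refine ⟨?_, rfl⟩
          rcases hs'.eq_or_lt with rfl | hlt
          · rfl
          · exact (hsmin s' hlt hxy.symm).elim
        · exfalso
          rcases lt_trichotomy j' k with h | rfl | h
          · exact hjmax j' hlt h s' (by omega) hxy.symm
          · exact (hrb s' (by omega)).2 hxy
          · obtain rfl : j' = min (k + 1) m := by omega
            exact (hcross s' (by omega) B le_rfl (by omega)).2 (hqB ▸ hxy)
      · exact ((hcross s' (by omega) t ht htd).2 hxy).elim
  -- The edge to `r s` gives `≤`; `h1` and the triangle inequality through `p j` give `≥`.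
  have hju : G.dist u (p j) = s + 1 := by
    have e1 := hP.dist_le_add (s := j) (by omega)
    have e2 := hjs.symm.reachable.dist_triangle_right u
    have e3 : G.Reachable u (r s) := by
      obtain ⟨w, -⟩ := hrwalk (S := Set.univ) (Nat.zero_le s) hsi.le (fun _ _ _ => trivial)
      rw [hr0] at w
      exact ⟨w⟩
    have e4 := e3.dist_triangle_left (p j)
    rw [dist_eq_one_iff_adj.2 hjs.symm, hrd s hsi.le] at e4
    omega
  -- some `r β` touches the final part of the path
  obtain ⟨β, hβs, t, hkt, htm, hβt⟩ : ∃ β ≤ s, ∃ t, k + 2 ≤ t ∧ t ≤ m ∧ G.Adj (r β) (p t) := by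
    by_contra! hno
    have hno' : ∀ s' ≤ s, ∀ t, k ≤ t → t ≤ m → ¬ G.Adj (r s') (p t) := by
      intro s' hs' t ht htm hadj
      rcases ht.eq_or_lt with rfl | h
      · exact (hrb s' (by omega)).2 hadj
      rcases (Nat.succ_le_of_lt h).eq_or_lt with h | h
      · obtain rfl : t = min (k + 1) m := by omega
        exact (hcross s' (by omega) B le_rfl (by omega)).2 (hqB ▸ hadj)
      · exact hno s' hs' t h htm hadj
    have hX : G.WalkIn {x | (∃ s' ≤ s, x = r s') ∨ ∃ j', j ≤ j' ∧ j' < k ∧ x = p j'} u (p (k - 1))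
        (s + 1 + (k - 1 - j)) := by
      have e1 := hrwalk (S := {x | (∃ s' ≤ s, x = r s') ∨ ∃ j', j ≤ j' ∧ j' < k ∧ x = p j'})
        (Nat.zero_le s) hsi.le (fun j _ h => Or.inl ⟨j, h, rfl⟩)
      have e2 := hP.walkIn (S := {x | (∃ s' ≤ s, x = r s') ∨ ∃ j', j ≤ j' ∧ j' < k ∧ x = p j'})
        (s := j) (t := k - 1) (by omega) (by omega) (fun j' h h' => Or.inr ⟨j', h, by omega, rfl⟩)
      rw [hr0] at e1
      exact ((e1.trans (.single (Or.inl ⟨s, le_rfl, rfl⟩) (Or.inr ⟨j, le_rfl, hjk, rfl⟩)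
        hjs.symm)).trans e2).mono subset_rfl (by omega)
    have hY := hP.walkIn (S := {y | ∃ t, k ≤ t ∧ t ≤ m ∧ y = p t}) hkm le_rfl
      (fun t h h' => ⟨t, h, h', rfl⟩)
    rw [hP.last] at hY
    have hadj : G.Adj (p (k - 1)) (p k) := by
      have := hP.adj (k - 1) (by omega)
      rwa [Nat.sub_add_cancel (by omega)] at this
    -- Otherwise the edge from `p (k - 1)` to `p k` is the only connection, hence on a geodesic, and
    -- the final geodesic part would begin before `k`.
    have := hP.dist_add_dist_le hX hY hadj ?_ ?_ (by omega)
    · have e1 := (hP.dist_suffix hk le_rfl hkm).2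
      have e2 := hkmin (k - 1) (by omega)
      omega
    · rintro (⟨s', hs', h⟩ | ⟨j', h1, h2, h⟩)
      · exact hrv s' (by omega) h.symm
      · rw [← hP.last] at h
        have := hP.inj _ _ le_rfl (by omega) h
        omega
    · rintro x (⟨s', hs', rfl⟩ | ⟨j', h1, h2, rfl⟩) y ⟨t, ht, htm, rfl⟩ hxy
      · exact (hno' s' hs' t ht htm hxy).elim
      · have := hP.ind _ _ (by omega) htm hxy
        obtain rfl : j' = k - 1 := by omega
        obtain rfl : t = k := by omega
        exact ⟨rfl, rfl⟩
  have hpt := (hP.dist_suffix hk (by omega : k ≤ t) htm).1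
  have hpk := (hP.dist_suffix hk le_rfl hkm).1
  have hrreach : ∀ s ≤ i, G.Reachable u (r s) := by
    intro s hs
    obtain ⟨w, -⟩ := hrwalk (S := Set.univ) (Nat.zero_le s) hs (fun _ _ _ => trivial)
    rw [hr0] at w
    exact ⟨w⟩
  have hβ1 : β ≤ G.dist u (p t) + 1 := by
    have e1 := (hP.reachable_from htm).dist_triangle_left (r β)
    rw [dist_eq_one_iff_adj.2 hβt.symm, hrd β (by omega)] at e1
    omega
  have hβ2 : G.dist u (p t) ≤ β + 1 := by
    have e1 := (hrreach β (by omega)).dist_triangle_left (p t)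
    rw [dist_eq_one_iff_adj.2 hβt, hrd β (by omega)] at e1
    omega
  -- The last cut uses the edge from `p j` to `r s` in the opposite direction: reach `p j` by a
  -- geodesic to `p k` and back along the path, and leave `r s` via `r β` and `p t`. Both ends of
  -- this edge are reached from `u` in the wrong order, so it is on no geodesic. As `β` is at least
  -- `D + 1`, distances from `u` separate the two sides except near `p k`, where `hrb` applies.
  obtain ⟨δ, hδ0, hδb, hδadj, hδ⟩ := (hP.reachable_from hkm).exists_seq
  set D := G.dist u (p k) with hD
  have hX : G.WalkIn {x | (∃ l ≤ D, x = δ l) ∨ ∃ j', j ≤ j' ∧ j' ≤ k ∧ x = p j'} u (p j)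
      (D + (k - j)) := by
    have e1 := WalkIn.of_seq (G := G)
      (S := {x | (∃ l ≤ D, x = δ l) ∨ ∃ j', j ≤ j' ∧ j' ≤ k ∧ x = p j'}) (f := δ)
      (Nat.zero_le D) (fun s _ h => hδadj s h) (fun j _ h => Or.inl ⟨j, h, rfl⟩)
    have e2 := hP.walkIn (S := {x | (∃ l ≤ D, x = δ l) ∨ ∃ j', j ≤ j' ∧ j' ≤ k ∧ x = p j'})
      hjk.le hkm (fun j' h h' => Or.inr ⟨j', h, by omega, rfl⟩)
    rw [hδ0, hδb] at e1
    exact e1.trans e2.symm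
  have hY : G.WalkIn {y | (∃ s', β ≤ s' ∧ s' ≤ s ∧ y = r s') ∨ ∃ t', t ≤ t' ∧ t' ≤ m ∧ y = p t'}
      (r s) v ((s - β) + 1 + (m - t)) := by
    have e1 := hrwalk (S := {y | (∃ s', β ≤ s' ∧ s' ≤ s ∧ y = r s') ∨
      ∃ t', t ≤ t' ∧ t' ≤ m ∧ y = p t'}) hβs hsi.le (fun j h h' => Or.inl ⟨j, h, h', rfl⟩)
    have e2 := hP.walkIn (S := {y | (∃ s', β ≤ s' ∧ s' ≤ s ∧ y = r s') ∨
      ∃ t', t ≤ t' ∧ t' ≤ m ∧ y = p t'}) htm le_rfl (fun j' h h' => Or.inr ⟨j', h, by omega, rfl⟩)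
    rw [hP.last] at e2
    exact (e1.symm.trans (.single (Or.inl ⟨β, le_rfl, hβs, rfl⟩) (Or.inr ⟨t, le_rfl, htm, rfl⟩)
      hβt)).trans e2
  have hDv : D < d := by omega
  have := hP.dist_add_dist_le hX hY hjs ?_ ?_ (by omega)
  · have e1 := (hrreach s hsi.le).dist_triangle_left v
    rw [hrd s hsi.le] at e1
    omega
  · rintro (⟨l, hl, h⟩ | ⟨j', h1, h2, h⟩)
    · have := hδ l hl
      rw [← h] at this
      omega
    · rw [← hP.last] at h
      have := hP.inj _ _ le_rfl (by omega) h
      omega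
  · rintro x (⟨l, hl, rfl⟩ | ⟨j', h1, h2, rfl⟩) y (⟨s', hs', hs'', rfl⟩ | ⟨t', ht', htm', rfl⟩) hxy
    · exfalso
      rcases hl.eq_or_lt with rfl | hl
      · rw [hδb] at hxy
        exact (hrb s' (by omega)).2 hxy.symm
      · have e1 := ((hrreach s' (by omega)).trans hxy.symm.reachable).dist_triangle_left (r s')
        rw [dist_eq_one_iff_adj.2 hxy, hrd s' (by omega), hδ l hl.le] at e1
        omega
    · exfalso
      have e2 := (hP.dist_suffix hk (by omega : k ≤ t') htm').1
      have e1 := ((hP.reachable_from htm').trans hxy.symm.reachable).dist_triangle_left (p t')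
      rw [dist_eq_one_iff_adj.2 hxy, hδ l hl] at e1
      omega
    · rcases h1.eq_or_lt with rfl | h1
      · rcases hs''.eq_or_lt with rfl | h
        · exact ⟨rfl, rfl⟩
        · exact (hsmin s' h hxy).elim
      · rcases h2.eq_or_lt with rfl | h2
        · exact ((hrb s' (by omega)).2 hxy.symm).elim
        · exact (hjmax j' h1 h2 s' (by omega) hxy).elim
    · have := hP.ind _ _ (by omega) htm' hxy
      omega

end IsShortestNSP

end SimpleGraph

/-! ### The searchable characterisation, and why it yields an NSP. -/

namespace SimpleGraph

open Relation

variable {V : Type*} {G : SimpleGraph V} {u v a b b' x y x' y' : V}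

theorem Adj.dist_le_succ (h : G.Adj x y) (hr : G.Reachable u x) :
    G.dist u y ≤ G.dist u x + 1 := by
  have := hr.dist_triangle_left y
  rwa [dist_eq_one_iff_adj.2 h] at this

/-- The edge `xy` leads away from `u`. -/
def Up (G : SimpleGraph V) (u x y : V) : Prop :=
  G.Adj x y ∧ G.Reachable u x ∧ G.dist u y = G.dist u x + 1

def SameDist (G : SimpleGraph V) (u x y : V) : Prop :=
  G.Reachable u x ∧ G.Reachable u y ∧ G.dist u x = G.dist u y

def LtDist (G : SimpleGraph V) (u x y : V) : Prop :=
  G.Reachable u x ∧ G.Reachable u y ∧ G.dist u x < G.dist u y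

/-- The exception for `a` is needed because `a` and `b` may be consecutive on the path. -/
def Apart (G : SimpleGraph V) (a b x y : V) : Prop :=
  x ≠ y ∧ ¬ G.Adj x y ∧ (x = a ∨ x ≠ b ∧ ¬ G.Adj x b)

/-- One step of the simultaneous search for a geodesic from `u` to `a` and one starting in `b'`. -/
def PairStep (G : SimpleGraph V) (u a b b' : V) (s t : V × V) : Prop :=
  G.Apart a b t.1 t.2 ∧ ¬ G.Adj s.1 t.2 ∧ ¬ G.Adj t.1 s.2 ∧
    (G.Up u s.1 t.1 ∧ G.Up u s.2 t.2 ∧ G.SameDist u s.1 s.2 ∨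
      G.Up u s.1 t.1 ∧ s.2 = t.2 ∧ s.2 = b' ∧ G.LtDist u s.1 s.2 ∨
      s.1 = t.1 ∧ s.1 = a ∧ G.Up u s.2 t.2)

def PairFwd (G : SimpleGraph V) (u a b b' x y : V) : Prop :=
  (G.Apart a b u b' ∧ G.LtDist u u b') ∧ ReflTransGen (G.PairStep u a b b') (u, b') (x, y)

def PairMid (G : SimpleGraph V) (u v a b b' x y : V) : Prop :=
  G.PairFwd u a b b' x y ∧ ReflTransGen (G.PairStep u a b b') (x, y) (a, v)

/-- All complete runs block at once, so a link avoiding blocked vertices fits whichever run is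
chosen. The vertex `a` does not block, since the link starts at one of its neighbours. -/
def Blocked (G : SimpleGraph V) (u v a b b' z : V) : Prop :=
  ∃ x y, G.PairMid u v a b b' x y ∧ x ≠ a ∧ (z = x ∨ G.Adj z x)

/-- The edge `ac` is not on a geodesic from `u` to `v`. -/
def Turn (G : SimpleGraph V) (u v a c : V) : Prop :=
  G.Reachable u a ∧ G.Reachable v c ∧ G.Reachable u v ∧
    G.dist u v < G.dist u a + G.dist v c + 1

def LinkStart (G : SimpleGraph V) (u v a b b' c : V) : Prop :=
  ¬ G.Blocked u v a b b' c ∧ G.PairFwd u a b b' a v ∧ G.Adj a c ∧ G.Turn u v a c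

/-- Only the first vertex of a link may be adjacent to `a`; this makes the first edge a cut edge. -/
def LinkStep (G : SimpleGraph V) (u v a b b' z z' : V) : Prop :=
  ¬ G.Blocked u v a b b' z' ∧ G.Adj z z' ∧ ¬ G.Adj z' a ∧ z' ≠ a

def Link (G : SimpleGraph V) (u v a b b' z : V) : Prop :=
  ∃ c, G.LinkStart u v a b b' c ∧ ReflTransGen (G.LinkStep u v a b b') c z

/-- The case `b = b'` is for paths whose final geodesic part is the vertex `v` alone. -/
def HasDetour (G : SimpleGraph V) (u v : V) : Prop :=
  ∃ a b b', G.Link u v a b b' b ∧ (b = b' ∨ G.Adj b b')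

/-- The two geodesics that a run of the simultaneous search has found. -/
structure Track (G : SimpleGraph V) (u a b b' x y : V) (r q : ℕ → V) : Prop where
  reachx : G.Reachable u x
  reachb : G.Reachable u b'
  r_zero : r 0 = u
  r_last : r (G.dist u x) = x
  r_adj : ∀ s < G.dist u x, G.Adj (r s) (r (s + 1))
  r_dist : ∀ s ≤ G.dist u x, G.dist u (r s) = s
  q_first : q (G.dist u b') = b'
  q_last : q (G.dist u y) = y
  q_adj : ∀ t, G.dist u b' ≤ t → t < G.dist u y → G.Adj (q t) (q (t + 1))
  q_dist : ∀ t, G.dist u b' ≤ t → t ≤ G.dist u y → G.dist u (q t) = t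
  b_le : G.dist u b' ≤ G.dist u y
  cross : ∀ s ≤ G.dist u x, ∀ t, G.dist u b' ≤ t → t ≤ G.dist u y → r s ≠ q t ∧ ¬ G.Adj (r s) (q t)
  away : ∀ s ≤ G.dist u x, r s = a ∨ r s ≠ b ∧ ¬ G.Adj (r s) b
  le : G.dist u x ≤ G.dist u y
  -- Once the run is complete, this makes every vertex of `r` other than `a` block its neighbours.
  visit : ∀ s ≤ G.dist u x, ∃ z, ReflTransGen (G.PairStep u a b b') (u, b') (r s, z) ∧
    ReflTransGen (G.PairStep u a b b') (r s, z) (x, y)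

namespace Track

variable {r q : ℕ → V}

theorem r_reach (h : G.Track u a b b' x y r q) {s : ℕ} (hs : s ≤ G.dist u x) :
    G.Reachable u (r s) := by
  obtain ⟨w, -⟩ := WalkIn.of_seq (S := Set.univ) (Nat.zero_le s)
    (fun t _ ht => h.r_adj t (by omega)) (fun _ _ _ => trivial)
  rw [h.r_zero] at w
  exact ⟨w⟩

theorem q_reach (h : G.Track u a b b' x y r q) {t : ℕ} (h₁ : G.dist u b' ≤ t)
    (h₂ : t ≤ G.dist u y) : G.Reachable u (q t) := by
  obtain ⟨w, -⟩ := WalkIn.of_seq (S := Set.univ) h₁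
    (fun s hs ht => h.q_adj s hs (by omega)) (fun _ _ _ => trivial)
  rw [h.q_first] at w
  exact h.reachb.trans ⟨w⟩

theorem start (hA : G.Apart a b u b') (hb : G.LtDist u u b') :
    G.Track u a b b' u b' (fun _ => u) (fun _ => b') where
  reachx := .refl _
  reachb := hb.2.1
  r_zero := rfl
  r_last := rfl
  r_adj := by simp
  r_dist := by simp
  q_first := rfl
  q_last := rfl
  q_adj := fun t h h' => by omega
  q_dist := fun t h h' => by omega
  b_le := le_rfl
  cross := fun _ _ _ _ _ => ⟨hA.1, hA.2.1⟩
  away := fun _ _ => hA.2.2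
  le := by simp
  visit := fun _ _ => ⟨b', .refl, .refl⟩

/-- As long as only the first geodesic grows, the second consists of `b'` alone, so one comparison
suffices. -/
theorem extend_left (h : G.Track u a b b' x y r q) (hU : G.Up u x x') (hy : y = b')
    (hlt : G.dist u x < G.dist u y) (hA : G.Apart a b x' y)
    (hS : G.PairStep u a b b' (x, y) (x', y)) :
    G.Track u a b b' x' y (Function.update r (G.dist u x + 1) x') q := by
  obtain ⟨hadj, -, hd⟩ := hU
  have hlow : ∀ s ≤ G.dist u x, Function.update r (G.dist u x + 1) x' s = r s :=
    fun s hs => Function.update_of_ne (by omega) _ _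
  have htop : Function.update r (G.dist u x + 1) x' (G.dist u x + 1) = x' :=
    Function.update_self ..
  have hq : ∀ t, G.dist u b' ≤ t → t ≤ G.dist u y → q t = y := by
    subst hy
    intro t h1 h2
    rw [le_antisymm h2 h1, h.q_last]
  refine { h with
    reachx := h.reachx.trans hadj.reachable, r_zero := ?_, r_last := ?_, r_adj := ?_, r_dist := ?_,
    cross := ?_, away := ?_, le := ?_, visit := ?_ }
  · rw [hlow 0 (by omega), h.r_zero]
  · rw [hd, htop]
  · intro s hs
    rcases (show s < G.dist u x ∨ s = G.dist u x by omega) with hs | rfl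
    · rw [hlow s hs.le, hlow _ hs]; exact h.r_adj s hs
    · rw [hlow _ le_rfl, htop, h.r_last]; exact hadj
  · intro s hs
    rcases (show s ≤ G.dist u x ∨ s = G.dist u x + 1 by omega) with hs | rfl
    · rw [hlow s hs]; exact h.r_dist s hs
    · rw [htop, hd]
  · intro s hs t h1 h2
    rcases (show s ≤ G.dist u x ∨ s = G.dist u x + 1 by omega) with hs | rfl
    · rw [hlow s hs]; exact h.cross s hs t h1 h2
    · rw [htop, hq t h1 h2]; exact ⟨hA.1, hA.2.1⟩
  · intro s hs
    rcases (show s ≤ G.dist u x ∨ s = G.dist u x + 1 by omega) with hs | rfl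
    · rw [hlow s hs]; exact h.away s hs
    · rw [htop]; exact hA.2.2
  · omega
  · intro s hs
    rcases (show s ≤ G.dist u x ∨ s = G.dist u x + 1 by omega) with hs | rfl
    · rw [hlow s hs]
      obtain ⟨z, h1, h2⟩ := h.visit s hs
      exact ⟨z, h1, h2.tail hS⟩
    · rw [htop]
      obtain ⟨z, h1, h2⟩ := h.visit _ le_rfl
      exact ⟨y, (h1.trans h2).tail hS, .refl⟩

/-- Distances from `u` of adjacent vertices differ by at most one, so the only vertex of `r` that
might be adjacent to the new vertex is the last one. -/
theorem extend_right (h : G.Track u a b b' x y r q) (hU : G.Up u y y')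
    (hA : G.Apart a b x y') (hS : G.PairStep u a b b' (x, y) (x, y')) :
    G.Track u a b b' x y' r (Function.update q (G.dist u y + 1) y') := by
  obtain ⟨hadj, hry, hd⟩ := hU
  have hlow : ∀ s ≤ G.dist u y, Function.update q (G.dist u y + 1) y' s = q s :=
    fun s hs => Function.update_of_ne (by omega) _ _
  have htop : Function.update q (G.dist u y + 1) y' (G.dist u y + 1) = y' :=
    Function.update_self ..
  have hle := h.le
  have hble := h.b_le
  refine { h with
    q_first := ?_, q_last := ?_, q_adj := ?_, q_dist := ?_, b_le := by omega,
    cross := ?_, le := by omega, visit := ?_ }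
  · rw [hlow _ h.b_le, h.q_first]
  · rw [hd, htop]
  · intro s h1 hs
    rcases (show s < G.dist u y ∨ s = G.dist u y by omega) with hs | rfl
    · rw [hlow s hs.le, hlow _ hs]; exact h.q_adj s h1 hs
    · rw [hlow _ le_rfl, htop, h.q_last]; exact hadj
  · intro s h1 hs
    rcases (show s ≤ G.dist u y ∨ s = G.dist u y + 1 by omega) with hs | rfl
    · rw [hlow s hs]; exact h.q_dist s h1 hs
    · rw [htop, hd]
  · intro s hs t h1 h2
    rcases (show t ≤ G.dist u y ∨ t = G.dist u y + 1 by omega) with ht | rfl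
    · rw [hlow t ht]; exact h.cross s hs t h1 ht
    · rw [htop]
      have e1 := h.r_dist s hs
      constructor
      · rintro rfl
        omega
      · intro hsy
        have e2 := hsy.dist_le_succ (h.r_reach hs)
        obtain rfl : s = G.dist u x := by omega
        rw [h.r_last] at hsy
        exact hA.2.1 hsy
  · intro s hs
    obtain ⟨z, h1, h2⟩ := h.visit s hs
    exact ⟨z, h1, h2.tail hS⟩

/-- Only edges within a level or between consecutive levels are possible; the three nonadjacencies
demanded of a step are exactly those that involve a new vertex. -/
theorem extend_both (h : G.Track u a b b' x y r q) (hU : G.Up u x x') (hU' : G.Up u y y')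
    (heq : G.dist u x = G.dist u y) (hA : G.Apart a b x' y') (hxy' : ¬ G.Adj x y')
    (hx'y : ¬ G.Adj x' y) (hS : G.PairStep u a b b' (x, y) (x', y')) :
    G.Track u a b b' x' y' (Function.update r (G.dist u x + 1) x')
      (Function.update q (G.dist u y + 1) y') := by
  obtain ⟨hadj, hrx, hd⟩ := hU
  obtain ⟨hadj', hry, hd'⟩ := hU'
  have hlow : ∀ s ≤ G.dist u x, Function.update r (G.dist u x + 1) x' s = r s :=
    fun s hs => Function.update_of_ne (by omega) _ _
  have htop : Function.update r (G.dist u x + 1) x' (G.dist u x + 1) = x' :=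
    Function.update_self ..
  have hlow' : ∀ s ≤ G.dist u y, Function.update q (G.dist u y + 1) y' s = q s :=
    fun s hs => Function.update_of_ne (by omega) _ _
  have htop' : Function.update q (G.dist u y + 1) y' (G.dist u y + 1) = y' :=
    Function.update_self ..
  have hble := h.b_le
  have hrx' : G.Reachable u x' := h.reachx.trans hadj.reachable
  refine {
    reachx := hrx', reachb := h.reachb, r_zero := ?_, r_last := ?_, r_adj := ?_, r_dist := ?_,
    q_first := ?_, q_last := ?_, q_adj := ?_, q_dist := ?_, b_le := by omega,
    cross := ?_, away := ?_, le := by omega, visit := ?_ }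
  · rw [hlow 0 (by omega), h.r_zero]
  · rw [hd, htop]
  · intro s hs
    rcases (show s < G.dist u x ∨ s = G.dist u x by omega) with hs | rfl
    · rw [hlow s hs.le, hlow _ hs]; exact h.r_adj s hs
    · rw [hlow _ le_rfl, htop, h.r_last]; exact hadj
  · intro s hs
    rcases (show s ≤ G.dist u x ∨ s = G.dist u x + 1 by omega) with hs | rfl
    · rw [hlow s hs]; exact h.r_dist s hs
    · rw [htop, hd]
  · rw [hlow' _ h.b_le, h.q_first]
  · rw [hd', htop']
  · intro s h1 hs
    rcases (show s < G.dist u y ∨ s = G.dist u y by omega) with hs | rfl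
    · rw [hlow' s hs.le, hlow' _ hs]; exact h.q_adj s h1 hs
    · rw [hlow' _ le_rfl, htop', h.q_last]; exact hadj'
  · intro s h1 hs
    rcases (show s ≤ G.dist u y ∨ s = G.dist u y + 1 by omega) with hs | rfl
    · rw [hlow' s hs]; exact h.q_dist s h1 hs
    · rw [htop', hd']
  · intro s hs t h1 h2
    rcases (show s ≤ G.dist u x ∨ s = G.dist u x + 1 by omega) with hs | rfl <;>
    rcases (show t ≤ G.dist u y ∨ t = G.dist u y + 1 by omega) with ht | rfl
    · rw [hlow s hs, hlow' t ht]; exact h.cross s hs t h1 ht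
    · rw [hlow s hs, htop']
      have e1 := h.r_dist s hs
      constructor
      · rintro rfl
        omega
      · intro hsy
        have e2 := hsy.dist_le_succ (h.r_reach hs)
        obtain rfl : s = G.dist u x := by omega
        rw [h.r_last] at hsy
        exact hxy' hsy
    · rw [htop, hlow' t ht]
      have e1 := h.q_dist t h1 ht
      constructor
      · rintro rfl
        omega
      · intro hsy
        have e2 := hsy.symm.dist_le_succ (h.q_reach h1 ht)
        obtain rfl : t = G.dist u y := by omega
        rw [h.q_last] at hsy
        exact hx'y hsy
    · rw [htop, htop']
      exact ⟨hA.1, hA.2.1⟩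
  · intro s hs
    rcases (show s ≤ G.dist u x ∨ s = G.dist u x + 1 by omega) with hs | rfl
    · rw [hlow s hs]; exact h.away s hs
    · rw [htop]; exact hA.2.2
  · intro s hs
    rcases (show s ≤ G.dist u x ∨ s = G.dist u x + 1 by omega) with hs | rfl
    · rw [hlow s hs]
      obtain ⟨z, h1, h2⟩ := h.visit s hs
      exact ⟨z, h1, h2.tail hS⟩
    · rw [htop]
      obtain ⟨z, h1, h2⟩ := h.visit _ le_rfl
      rw [h.r_last] at h1 h2
      exact ⟨y', (h1.trans h2).tail hS, .refl⟩

theorem extend (h : G.Track u a b b' x y r q) (hS : G.PairStep u a b b' (x, y) (x', y')) :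
    ∃ r' q', G.Track u a b b' x' y' r' q' ∧ G.dist u x ≤ G.dist u x' ∧
      ∀ s ≤ G.dist u x, r' s = r s := by
  have hS' := hS
  obtain ⟨hA, h1, h2, ⟨hU, hU', hD⟩ | ⟨hU, he, hb, hL⟩ | ⟨he, -, hU⟩⟩ := hS'
  · exact ⟨_, _, h.extend_both hU hU' hD.2.2 hA h1 h2 hS, by have := hU.2.2; simp only at this; omega,
      fun s hs => Function.update_of_ne (by omega) _ _⟩
  · simp only at he
    subst he
    exact ⟨_, _, h.extend_left hU hb hL.2.2 hA hS, by have := hU.2.2; simp only at this; omega,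
      fun s hs => Function.update_of_ne (by omega) _ _⟩
  · simp only at he
    subst he
    exact ⟨_, _, h.extend_right hU hA hS, le_rfl, fun _ _ => rfl⟩

theorem extend_many (h : G.Track u a b b' x y r q) {s : V × V}
    (hS : ReflTransGen (G.PairStep u a b b') (x, y) s) :
    ∃ r' q', G.Track u a b b' s.1 s.2 r' q' ∧ G.dist u x ≤ G.dist u s.1 ∧
      ∀ j ≤ G.dist u x, r' j = r j := by
  induction hS with
  | refl => exact ⟨r, q, h, le_rfl, fun _ _ => rfl⟩
  | tail _ hst ih =>
    obtain ⟨r', q', h', hle, hagree⟩ := ih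
    obtain ⟨r'', q'', h'', hle', hagree'⟩ := h'.extend hst
    exact ⟨r'', q'', h'', hle.trans hle', fun j hj => by
      rw [hagree' j (hj.trans hle), hagree j hj]⟩

end Track

theorem PairFwd.exists_track (h : G.PairFwd u a b b' x y) : ∃ r q, G.Track u a b b' x y r q := by
  obtain ⟨r, q, h, -⟩ := (Track.start h.1.1 h.1.2).extend_many h.2
  exact ⟨r, q, h⟩

/-- Extending a run keeps the geodesic found so far, so `x` remains on it. -/
theorem PairMid.exists_track (h : G.PairMid u v a b b' x y) :
    ∃ r q, G.Track u a b b' a v r q ∧ ∃ s ≤ G.dist u a, r s = x := by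
  obtain ⟨r, q, h1⟩ := h.1.exists_track
  obtain ⟨r', q', h2, hle, hag⟩ := h1.extend_many h.2
  exact ⟨r', q', h2, G.dist u x, hle, by rw [hag _ le_rfl, h1.r_last]⟩

/-- For any complete run, take the first geodesic on one side and the link with the second geodesic
on the other; `Turn` makes the induced path through `ac` too long to be a geodesic. -/
theorem HasDetour.hasNSP (h : G.HasDetour u v) : G.HasNSP u v := by
  obtain ⟨a, b, b', ⟨c, ⟨hcB, hF, hac, hra, hrc, hrv, hT⟩, hL⟩, hbb⟩ := h
  obtain ⟨r, q, hR⟩ := hF.exists_track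
  have hX : G.WalkIn {x | ∃ s ≤ G.dist u a, x = r s} u a (G.dist u a) := by
    have := WalkIn.of_seq (G := G) (S := {x | ∃ s ≤ G.dist u a, x = r s}) (Nat.zero_le (G.dist u a))
      (fun s _ h => hR.r_adj s h) (fun s _ h => ⟨s, h, rfl⟩)
    rwa [hR.r_zero, hR.r_last] at this
  set Y : Set V := {y | (¬ G.Blocked u v a b b' y ∧ y ≠ a ∧ (y = c ∨ ¬ G.Adj y a)) ∨
    ∃ t, G.dist u b' ≤ t ∧ t ≤ G.dist u v ∧ y = q t} with hYdef
  have hcY : c ∈ Y := Or.inl ⟨hcB, hac.ne', .inl rfl⟩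
  have hY1 : ∀ z, ReflTransGen (G.LinkStep u v a b b') c z → z ∈ Y ∧ ∃ l, G.WalkIn Y c z l := by
    intro z hz
    induction hz with
    | refl => exact ⟨hcY, 0, .refl hcY⟩
    | @tail z z' _ hzz ih =>
      have hz' : z' ∈ Y := Or.inl ⟨hzz.1, hzz.2.2.2, .inr hzz.2.2.1⟩
      obtain ⟨hz, l, hl⟩ := ih
      exact ⟨hz', _, hl.trans (.single hz hz' hzz.2.1)⟩
  obtain ⟨hbY, l, hl⟩ := hY1 b hL
  have hb'Y : b' ∈ Y := Or.inr ⟨_, le_rfl, hR.b_le, hR.q_first.symm⟩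
  have hY : ∃ l, G.WalkIn Y c v l := by
    have e := WalkIn.of_seq (G := G) (S := Y) hR.b_le hR.q_adj (fun t h h' => Or.inr ⟨t, h, h', rfl⟩)
    rw [hR.q_first, hR.q_last] at e
    rcases hbb with rfl | hbb
    · exact ⟨_, hl.trans e⟩
    · exact ⟨_, (hl.trans (.single hbY hb'Y hbb)).trans e⟩
  obtain ⟨l, hY⟩ := hY
  have hvX : v ∉ {x | ∃ s ≤ G.dist u a, x = r s} := by
    rintro ⟨s, hs, h⟩
    exact (hR.cross s hs (G.dist u v) hR.b_le le_rfl).1 (by rw [hR.q_last, h])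
  have hcross : ∀ x ∈ {x | ∃ s ≤ G.dist u a, x = r s}, ∀ y ∈ Y, G.Adj x y → x = a ∧ y = c := by
    rintro x ⟨s, hs, rfl⟩ y (⟨hB, hya, hy⟩ | ⟨t, ht, ht', rfl⟩) hxy
    · by_cases hra : r s = a
      · rw [hra] at hxy
        exact ⟨hra, hy.resolve_right (fun h => h hxy.symm)⟩
      · obtain ⟨z, h1, h2⟩ := hR.visit s hs
        exact (hB ⟨r s, z, ⟨⟨hF.1, h1⟩, h2⟩, hra, .inr hxy.symm⟩).elim
    · exact ((hR.cross s hs t ht ht').2 hxy).elim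
  obtain ⟨p, hp, -, hlen⟩ := exists_isInducedPath_of_cut hX hY hac hvX hcross
  refine ⟨p, hp, ?_⟩
  rw [← hrv.coe_dist_eq_edist, Nat.cast_lt]
  rw [dist_comm (u := c)] at hlen
  omega

end SimpleGraph

/-! ### Every shortest NSP is detected. -/

namespace SimpleGraph

open Relation

variable {V : Type*} {G : SimpleGraph V} {u v a b b' : V}

/-- Both sequences are indexed by distance from `u`. The first climbs alone up to level `B`, both
climb together up to level `A`, then the second climbs alone; if `A < B` the middle phase is empty.
-/
theorem reflTransGen_pairStep {r q : ℕ → V} {A B D : ℕ} (hA : r A = a) (hB : q B = b')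
    (hD : q D = v) (hr0 : r 0 = u) (hBD : B ≤ D) (hAD : A ≤ D)
    (hrr : ∀ s ≤ A, G.Reachable u (r s)) (hqr : ∀ t, B ≤ t → t ≤ D → G.Reachable u (q t))
    (hrd : ∀ s ≤ A, G.dist u (r s) = s) (hqd : ∀ t, B ≤ t → t ≤ D → G.dist u (q t) = t)
    (hra : ∀ s < A, G.Adj (r s) (r (s + 1)))
    (hqa : ∀ t, B ≤ t → t < D → G.Adj (q t) (q (t + 1)))
    (hcross : ∀ s ≤ A, ∀ t, B ≤ t → t ≤ D → r s ≠ q t ∧ ¬ G.Adj (r s) (q t))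
    (haway : ∀ s ≤ A, r s = a ∨ r s ≠ b ∧ ¬ G.Adj (r s) b) :
    ReflTransGen (G.PairStep u a b b') (u, b') (a, v) := by
  have hapart : ∀ s ≤ A, ∀ t, B ≤ t → t ≤ D → G.Apart a b (r s) (q t) := fun s hs t h h' =>
    ⟨(hcross s hs t h h').1, (hcross s hs t h h').2, haway s hs⟩
  have hrU : ∀ s < A, G.Up u (r s) (r (s + 1)) := fun s hs =>
    ⟨hra s hs, hrr s hs.le, by rw [hrd _ hs, hrd _ hs.le]⟩
  have hqU : ∀ t, B ≤ t → t < D → G.Up u (q t) (q (t + 1)) := fun t h h' =>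
    ⟨hqa t h h', hqr t h h'.le, by rw [hqd _ (by omega) h', hqd _ h h'.le]⟩
  have phase1 : ∀ s, s ≤ A → s ≤ B → ReflTransGen (G.PairStep u a b b') (u, b') (r s, q B) := by
    intro s
    induction s with
    | zero => intro _ _; rw [hr0, hB]
    | succ s ih =>
      intro h h'
      refine (ih (by omega) (by omega)).tail ⟨hapart _ h _ le_rfl hBD,
        (hcross _ (by omega) _ le_rfl hBD).2, (hcross _ h _ le_rfl hBD).2,
        .inr (.inl ⟨hrU s h, rfl, hB, hrr _ (by omega), hqr _ le_rfl hBD, ?_⟩)⟩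
      simp only
      rw [hrd s (by omega), hqd B le_rfl hBD]
      omega
  have phase2 : ∀ t, B ≤ t → t ≤ A → ReflTransGen (G.PairStep u a b b') (u, b') (r t, q t) := by
    intro t h
    induction t, h using Nat.le_induction with
    | base => exact fun h => phase1 B h le_rfl
    | succ t h ih =>
      intro h'
      refine (ih (by omega)).tail ⟨hapart _ h' _ (by omega) (by omega),
        (hcross _ (by omega) _ (by omega) (by omega)).2, (hcross _ h' _ h (by omega)).2,
        .inl ⟨hrU t h', hqU t h (by omega), hrr _ (by omega), hqr _ h (by omega), ?_⟩⟩
      simp only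
      rw [hrd t (by omega), hqd t h (by omega)]
  have phase3 : ∀ t, max A B ≤ t → t ≤ D →
      ReflTransGen (G.PairStep u a b b') (u, b') (r A, q t) := by
    intro t h
    induction t, h using Nat.le_induction with
    | base =>
      intro _
      rcases le_total A B with h | h
      · rw [max_eq_right h]; exact phase1 A le_rfl h
      · rw [max_eq_left h]; exact phase2 A h le_rfl
    | succ t h ih =>
      intro h'
      exact (ih (by omega)).tail ⟨hapart _ le_rfl _ (by omega) h',
        (hcross _ le_rfl _ (by omega) (by omega)).2, (hcross _ le_rfl _ (by omega) (by omega)).2,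
        .inr (.inr ⟨rfl, hA, hqU t (by omega) (by omega)⟩)⟩
  have := phase3 D (by omega) le_rfl
  rwa [hA, hD] at this

theorem HasNSP.exists_isShortestNSP (h : G.HasNSP u v) :
    ∃ p m, G.IsShortestNSP u v p m ∧ G.Reachable u v := by
  classical
  obtain ⟨w, hw, hl⟩ := h
  have hr : G.Reachable u v := ⟨w⟩
  have hex : ∃ m, ∃ w : G.Walk u v, w.IsInducedPath ∧ G.dist u v < w.length ∧ w.length = m := by
    refine ⟨_, w, hw, ?_, rfl⟩
    rwa [← hr.coe_dist_eq_edist, Nat.cast_lt] at hl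
  obtain ⟨w, hw, hl, hm⟩ := Nat.find_spec hex
  refine ⟨w.getVert, w.length, ⟨by simp, by simp, fun s t => hw.getVert_inj,
    fun s => w.adj_getVert_succ, fun s t => hw.getVert_adj, hl, ?_⟩, hr⟩
  intro w' hw' hl'
  rw [hm]
  exact Nat.find_min' hex ⟨w', hw', hl', rfl⟩

/-- The path itself supplies a complete run and a link; what needs proof is that no other run blocks
this link. -/
theorem HasNSP.hasDetour (h : G.HasNSP u v) : G.HasDetour u v := by
  classical
  obtain ⟨p, m, hP, hr⟩ := h.exists_isShortestNSP
  set d := G.dist u v with hd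
  -- the end `p i` of the initial geodesic part and the beginning `p k` of the final one
  obtain ⟨i, him, hi, himax⟩ : ∃ i, i ≤ m ∧ i + G.dist (p i) v ≤ d ∧
      ∀ j, i < j → j ≤ m → d < j + G.dist (p j) v := by
    let Q := fun i => i + G.dist (p i) v ≤ d
    have h0 : Q 0 := by simp [Q, hP.zero, hd]
    refine ⟨Nat.findGreatest Q m, Nat.findGreatest_le m,
      Nat.findGreatest_spec (P := Q) (Nat.zero_le m) h0, fun j h h' => ?_⟩
    have := Nat.findGreatest_is_greatest (P := Q) h h'
    simpa [Q] using this
  obtain ⟨k, hkm, hk, hkmin⟩ : ∃ k, k ≤ m ∧ G.dist u (p k) + (m - k) ≤ d ∧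
      ∀ k' < k, d < G.dist u (p k') + (m - k') := by
    have hex : ∃ k, G.dist u (p k) + (m - k) ≤ d := ⟨m, by rw [hP.last]; omega⟩
    refine ⟨Nat.find hex, Nat.find_min' hex (by rw [hP.last]; omega), Nat.find_spec hex, ?_⟩
    intro k' hk'
    exact not_le.1 (Nat.find_min hex hk')
  have hlt := hP.lt
  have hpre : ∀ {s}, s ≤ i → G.dist u (p s) = s := fun hs => hP.dist_prefix hi him hs
  have hsuf : ∀ {t}, k ≤ t → t ≤ m → G.dist u (p t) + m = d + t ∧ G.dist (p t) v = m - t :=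
    fun h h' => hP.dist_suffix hk h h'
  have hik : i < k := by
    by_contra hki
    have := (hsuf (not_lt.1 hki) him).2
    omega
  have hid : i < d := by
    have h1 := hP.dist_le_add him
    have h2 := hpre le_rfl
    rcases Nat.eq_zero_or_pos (G.dist (p i) v) with h0 | h0
    · rw [(hP.reachable_to him).dist_eq_zero_iff, ← hP.last] at h0
      have := hP.inj _ _ him le_rfl h0
      omega
    · omega
  have hiv : i + G.dist (p i) v = d := by
    have h1 := hP.dist_le_add him
    have h2 := hpre le_rfl
    omega
  -- Starting the second geodesic one vertex after `p k` keeps it nonadjacent to `p i` even if `k =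
  -- i + 1`. The minimum matters only when `p k = v`.
  set K := min (k + 1) m with hK
  have hKm : K ≤ m := min_le_right _ _
  have hkK : k ≤ K := by omega
  set B := G.dist u (p K) with hB
  have hBm : B + m = d + K := (hsuf hkK hKm).1
  have hiK : i + 1 < K := by
    rcases (show i + 1 < K ∨ i + 1 = m by omega) with h | h
    · exact h
    · exfalso
      have := hP.adj i (by omega)
      rw [h, hP.last] at this
      have := dist_eq_one_iff_adj.2 this
      omega
  -- The final part, reindexed by distance from `u`: `p K` is at level `B`.
  set q : ℕ → V := fun t => p (t + K - B) with hq
  have hqB : q B = p K := by simp [hq]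
  have hqd : q d = v := by
    have : d + K - B = m := by omega
    simp only [hq, this, hP.last]
  have hqadj : ∀ t, B ≤ t → t < d → G.Adj (q t) (q (t + 1)) := by
    intro t h h'
    have := hP.adj (t + K - B) (by omega)
    rwa [show t + K - B + 1 = t + 1 + K - B by omega] at this
  have hqdist : ∀ t, B ≤ t → t ≤ d → G.dist u (q t) = t := by
    intro t h h'
    have := (hsuf (t := t + K - B) (by omega) (by omega)).1
    simp only [hq]
    omega
  have hcross : ∀ s ≤ i, ∀ t, B ≤ t → t ≤ d → p s ≠ q t ∧ ¬ G.Adj (p s) (q t) := by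
    intro s hs t h h'
    refine ⟨fun he => ?_, fun ha => ?_⟩
    · have := hP.inj _ _ (by omega) (by omega) he
      omega
    · have := hP.ind _ _ (by omega) (by omega) ha
      omega
  have haway : ∀ s ≤ i, p s = p i ∨ p s ≠ p k ∧ ¬ G.Adj (p s) (p k) := by
    intro s hs
    rcases hs.eq_or_lt with rfl | hs
    · exact .inl rfl
    refine .inr ⟨fun he => ?_, fun ha => ?_⟩
    · have := hP.inj _ _ (by omega) (by omega) he
      omega
    · have := hP.ind _ _ (by omega) (by omega) ha
      omega
  have hF : G.PairFwd u (p i) (p k) (p K) (p i) v := by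
    refine ⟨⟨?_, .refl _, hP.reachable_from hKm, ?_⟩, ?_⟩
    · have := hcross 0 (Nat.zero_le _) B le_rfl (by omega)
      rw [hP.zero, hqB] at this
      have h' := haway 0 (Nat.zero_le _)
      rw [hP.zero] at h'
      exact ⟨this.1, this.2, h'⟩
    · have h1 := (hP.reachable_from hKm).dist_eq_zero_iff
      rw [dist_self, Nat.pos_iff_ne_zero, Ne, h1, ← hP.zero]
      intro he
      have := hP.inj _ _ (by omega) hKm he
      omega
    · exact reflTransGen_pairStep (r := p) (q := q) (A := i) (B := B) (D := d) rfl hqB hqd hP.zero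
        (by omega) (by omega) (fun s hs => hP.reachable_from (by omega))
        (fun t h h' => hP.reachable_from (by omega)) (fun s hs => hpre hs) hqdist
        (fun s hs => hP.adj s (by omega)) hqadj hcross haway
  -- Here `r` and `q'` come from an arbitrary complete run. The condition `away` settles `p k`, and
  -- `not_touching` the earlier vertices.
  have hblock : ∀ j, i < j → j ≤ k → ¬ G.Blocked u v (p i) (p k) (p K) (p j) := by
    rintro j hij hjk ⟨x, y, hM, hxa, hjx⟩
    obtain ⟨r, q', hT, s, hs, rfl⟩ := hM.exists_track
    have hdi : G.dist u (p i) = i := hpre le_rfl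
    have hrne : ∀ s < i, r s ≠ p i := by
      intro s hs he
      have := hT.r_dist s (by omega)
      rw [he, hdi] at this
      omega
    have hsi : s < i := by
      refine lt_of_le_of_ne (hdi ▸ hs) ?_
      rintro rfl
      rw [← hT.r_last, hdi] at hxa
      exact hxa rfl
    rcases hjk.eq_or_lt with rfl | hjk
    · have := (hT.away s hs).resolve_left hxa
      rcases hjx with h | h
      · exact this.1 h.symm
      · exact this.2 h.symm
    · have := hP.not_touching (i := i) (r := r) (q := q') (B := B) hk hkmin hkm hT.r_zero
        (fun s hs => hT.r_adj s (by omega)) (fun s hs => hT.r_dist s (by omega)) rfl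
        hT.q_first hT.q_last hT.q_adj (fun s hs => hT.cross s (by omega))
        (fun s hs => (hT.away s (by omega)).resolve_left (hrne s hs)) j hij hjk s hsi
      exact hjx.elim this.1 this.2
  refine ⟨p i, p k, p K, ⟨p (i + 1), ⟨hblock _ (by omega) hik, hF, hP.adj i (by omega),
    hP.reachable_from him, (hP.reachable_to (by omega)).symm, hr, ?_⟩, ?_⟩, ?_⟩
  · have := himax (i + 1) (by omega) (by omega)
    rw [hpre le_rfl, dist_comm (u := v)]
    omega
  · have : ∀ j, i + 1 ≤ j → j ≤ k → ReflTransGen (G.LinkStep u v (p i) (p k) (p K))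
        (p (i + 1)) (p j) := by
      intro j hj
      induction j, hj using Nat.le_induction with
      | base => intro _; exact .refl
      | succ j hj ih =>
        intro hjk
        refine (ih (by omega)).tail ⟨hblock _ (by omega) hjk, hP.adj j (by omega), fun ha => ?_,
          fun he => ?_⟩
        · have := hP.ind _ _ (by omega) (by omega) ha
          omega
        · have := hP.inj _ _ (by omega) (by omega) he
          omega
    exact this k hik le_rfl
  · rcases (show K = k ∨ K = k + 1 by omega) with h | h
    · exact .inl (by rw [h])
    · exact .inr (by rw [h]; exact hP.adj k (by omega))

theorem hasNSP_iff_hasDetour : G.HasNSP u v ↔ G.HasDetour u v :=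
  ⟨HasNSP.hasDetour, HasDetour.hasNSP⟩

end SimpleGraph

/-! ### Program fragments: addresses, guards and counting loops. -/

namespace WordRAM

variable {n : ℕ}

/-- A family of relations of arity five on the vertices. -/
abbrev DB (n : ℕ) := ℕ → Set (Fin 5 → Fin n)

/-- Quantifier-free conditions on a valuation of eleven variables. -/
inductive Guard where
  | rel (k : ℕ) (t : Fin 5 → Fin 11) : Guard
  | lt (x y z : Fin 11) (c : ℕ) : Guard
  | and (g h : Guard) : Guard
  | or (g h : Guard) : Guard
  | not (g : Guard) : Guard

namespace Guard

def Holds (A : DB n) (ρ : Fin 11 → Fin n) : Guard → Prop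
  | rel k t => (fun i => ρ (t i)) ∈ A k
  | lt x y z c => (ρ x : ℕ) < ρ y + ρ z + c
  | and g h => g.Holds A ρ ∧ h.Holds A ρ
  | or g h => g.Holds A ρ ∨ h.Holds A ρ
  | not g => ¬ g.Holds A ρ

/-- A bound for the constants that occur in the guard. -/
def bound : Guard → ℕ
  | rel k _ => k
  | lt _ _ _ c => c
  | and g h => g.bound + h.bound
  | or g h => g.bound + h.bound
  | not g => g.bound

def cost : Guard → ℕ
  | rel _ _ => 12
  | lt _ _ _ _ => 4
  | and g h => g.cost + h.cost + 2
  | or g h => g.cost + h.cost + 2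
  | not g => g.cost + 2

end Guard

/-- The address of the cell that holds the truth value of the fact `k(t)`. -/
def code (n k : ℕ) (t : Fin 5 → Fin n) : ℕ :=
  ((((k * n + t 0) * n + t 1) * n + t 2) * n + t 3) * n + t 4

theorem mul_add_inj {a b r s : ℕ} (hr : r < n) (hs : s < n) (h : a * n + r = b * n + s) :
    a = b ∧ r = s := by
  have h1 : (a * n + r) / n = a := by
    rw [mul_comm, Nat.mul_add_div (by omega), Nat.div_eq_of_lt hr, add_zero]
  have h2 : (b * n + s) / n = b := by
    rw [mul_comm, Nat.mul_add_div (by omega), Nat.div_eq_of_lt hs, add_zero]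
  have : a = b := by rw [← h1, ← h2, h]
  subst this
  exact ⟨rfl, by omega⟩

/-- The address is a base-`n` numeral with unbounded leading digit `k`, so distinct facts have
distinct cells. -/
theorem code_inj {k k' : ℕ} {t t' : Fin 5 → Fin n} (h : code n k t = code n k' t') :
    k = k' ∧ t = t' := by
  unfold code at h
  obtain ⟨h, h4⟩ := mul_add_inj (t 4).2 (t' 4).2 h
  obtain ⟨h, h3⟩ := mul_add_inj (t 3).2 (t' 3).2 h
  obtain ⟨h, h2⟩ := mul_add_inj (t 2).2 (t' 2).2 h
  obtain ⟨h, h1⟩ := mul_add_inj (t 1).2 (t' 1).2 h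
  obtain ⟨h, h0⟩ := mul_add_inj (t 0).2 (t' 0).2 h
  refine ⟨h, funext fun i => Fin.ext ?_⟩
  fin_cases i <;> assumption

theorem mul_add_lt {a b r : ℕ} (ha : a < b) (hr : r < n) : a * n + r < b * n := by
  calc a * n + r < a * n + n := by omega
    _ = (a + 1) * n := by ring
    _ ≤ b * n := Nat.mul_le_mul_right _ ha

theorem code_lt (k : ℕ) (t : Fin 5 → Fin n) : code n k t < (k + 1) * n ^ 5 := by
  have := mul_add_lt (mul_add_lt (mul_add_lt (mul_add_lt (mul_add_lt (Nat.lt_succ_self k)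
    (t 0).2) (t 1).2) (t 2).2) (t 3).2) (t 4).2
  calc code n k t < _ := this
    _ = (k + 1) * n ^ 5 := by rw [Nat.succ_eq_add_one]; ring

/-- The state `s` stores the relations `A` and the valuation `ρ`. -/
structure Rep (s : State) (A : DB n) (ρ : Fin 11 → Fin n) : Prop where
  size : s.reg 0 = n
  var : ∀ j : Fin 11, s.reg (j + 1) = ρ j
  mem_of_mem : ∀ k, ∀ t ∈ A k, s.mem (code n k t) = 1
  mem_of_not_mem : ∀ k, ∀ t ∉ A k, s.mem (code n k t) = 0

@[simp] theorem setReg_reg_self (s : State) (z a : ℕ) : (s.setReg z a).reg z = a := by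
  simp [State.setReg]

theorem setReg_reg_of_ne {s : State} {z a r : ℕ} (h : r ≠ z) : (s.setReg z a).reg r = s.reg r := by
  simp [State.setReg, h]

@[simp] theorem setReg_mem (s : State) (z a : ℕ) : (s.setReg z a).mem = s.mem := rfl

@[simp] theorem setReg_setReg (s : State) (z a b : ℕ) :
    (s.setReg z a).setReg z b = s.setReg z b := by
  simp [State.setReg]

/-- Registers from 12 on hold only scratch values and loop counters. -/
theorem Rep.setReg {s : State} {A : DB n} {ρ : Fin 11 → Fin n} (h : Rep s A ρ) {z a : ℕ}
    (hz : 12 ≤ z) : Rep (s.setReg z a) A ρ where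
  size := by rw [setReg_reg_of_ne (by omega), h.size]
  var := fun j => by rw [setReg_reg_of_ne (by omega), h.var]
  mem_of_mem := h.mem_of_mem
  mem_of_not_mem := h.mem_of_not_mem

/-- Append a digit to the number in register 12. -/
def push (x : Fin 11) : Prog := .seq (.mul 12 12 0) (.add 12 12 (x + 1))

theorem exec_push {W c : ℕ} {s : State} {A : DB n} {ρ : Fin 11 → Fin n} (h : Rep s A ρ)
    (x : Fin 11) (hW : c * n + ρ x < W) :
    Exec W (push x) (s.setReg 12 c) 2 (s.setReg 12 (c * n + ρ x)) := by
  have h0 : (s.setReg 12 c).reg 0 = n := by rw [setReg_reg_of_ne (by omega), h.size]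
  have e1 := Exec.mul (W := W) (s.setReg 12 c) 12 12 0 (by rw [h0, setReg_reg_self]; omega)
  rw [h0, setReg_reg_self, setReg_setReg] at e1
  have hx : (s.setReg 12 (c * n)).reg (x + 1) = ρ x := by
    rw [setReg_reg_of_ne (by omega), h.var]
  have e2 := Exec.add (W := W) (s.setReg 12 (c * n)) 12 12 (x + 1)
    (by rw [hx, setReg_reg_self]; omega)
  rw [hx, setReg_reg_self, setReg_setReg] at e2
  exact .seq e1 e2

/-- Compute an address in register 12. -/
def addr (k : ℕ) (t : Fin 5 → Fin 11) : Prog :=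
  .seq (.const 12 k) (.seq (push (t 0)) (.seq (push (t 1)) (.seq (push (t 2))
    (.seq (push (t 3)) (push (t 4))))))

theorem exec_addr {W k : ℕ} {s : State} {A : DB n} {ρ : Fin 11 → Fin n} (h : Rep s A ρ)
    (t : Fin 5 → Fin 11) (hW : (k + 1) * n ^ 5 ≤ W) :
    Exec W (addr k t) s 11 (s.setReg 12 (code n k fun i => ρ (t i))) := by
  have hn : 0 < n := (Nat.zero_le _).trans_lt (ρ 0).2
  have hlt := (code_lt k fun i => ρ (t i)).trans_le hW
  have hle : ∀ a r : ℕ, a ≤ a * n + r := fun a r =>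
    (Nat.le_mul_of_pos_right a hn).trans (Nat.le_add_right _ _)
  have b4 := (hle _ (ρ (t 4) : ℕ)).trans_lt hlt
  have b3 := (hle _ (ρ (t 3) : ℕ)).trans_lt b4
  have b2 := (hle _ (ρ (t 2) : ℕ)).trans_lt b3
  have b1 := (hle _ (ρ (t 1) : ℕ)).trans_lt b2
  have b0 := (hle _ (ρ (t 0) : ℕ)).trans_lt b1
  exact .seq (.const s 12 k b0) (.seq (exec_push h _ b1) (.seq (exec_push h _ b2)
    (.seq (exec_push h _ b3) (.seq (exec_push h _ b4) (exec_push h _ hlt)))))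

/-- Evaluate a guard in register 12. -/
def Guard.prog : Guard → Prog
  | rel k t => .seq (addr k t) (.load 12 12)
  | lt x y z c => .seq (.const 12 c) (.seq (.add 12 12 (y + 1)) (.seq (.add 12 12 (z + 1))
      (.sub 12 12 (x + 1))))
  | and g h => .seq g.prog (.cond 12 h.prog .skip)
  | or g h => .seq g.prog (.cond 12 .skip h.prog)
  | not g => .seq g.prog (.cond 12 (.const 12 0) (.const 12 1))

theorem Guard.exec_prog {W : ℕ} {A : DB n} {ρ : Fin 11 → Fin n} (g : Guard) :
    ∀ s : State, Rep s A ρ → (g.bound + 3) * n ^ 5 ≤ W →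
    ∃ t x, Exec W g.prog s t (s.setReg 12 x) ∧ t ≤ g.cost ∧ (x ≠ 0 ↔ g.Holds A ρ) := by
  have hn : 0 < n := (Nat.zero_le _).trans_lt (ρ 0).2
  have hn5 : n ≤ n ^ 5 := Nat.le_self_pow (by omega) n
  induction g with
  | rel k t =>
    intro s h hW
    have e := exec_addr (k := k) (W := W) h t
      ((Nat.mul_le_mul_right _ (by simp [Guard.bound])).trans hW)
    have e2 := Exec.load (W := W) (s.setReg 12 (code n k fun i => ρ (t i))) 12 12
    rw [setReg_reg_self, setReg_setReg, setReg_mem] at e2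
    refine ⟨_, _, .seq e e2, le_rfl, ?_⟩
    by_cases hm : (fun i => ρ (t i)) ∈ A k
    · simp [h.mem_of_mem _ _ hm, Guard.Holds, hm]
    · simp [h.mem_of_not_mem _ _ hm, Guard.Holds, hm]
  | lt x y z c =>
    intro s h hW
    have hb : c + 3 * n ≤ W := by
      refine le_trans ?_ hW
      simp only [Guard.bound]
      nlinarith
    have hv : ∀ (j : Fin 11) (a : ℕ), (s.setReg 12 a).reg (j + 1) = ρ j := fun j a => by
      rw [setReg_reg_of_ne (by omega), h.var]
    have e1 := Exec.const (W := W) s 12 c (by omega)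
    have e2 := Exec.add (W := W) (s.setReg 12 c) 12 12 (y + 1)
      (by rw [hv, setReg_reg_self]; omega)
    rw [hv, setReg_reg_self, setReg_setReg] at e2
    have e3 := Exec.add (W := W) (s.setReg 12 (c + ρ y)) 12 12 (z + 1)
      (by rw [hv, setReg_reg_self]; omega)
    rw [hv, setReg_reg_self, setReg_setReg] at e3
    have e4 := Exec.sub (W := W) (s.setReg 12 (c + ρ y + ρ z)) 12 12 (x + 1)
    rw [hv, setReg_reg_self, setReg_setReg] at e4
    exact ⟨_, _, .seq e1 (.seq e2 (.seq e3 e4)), le_rfl, by simp only [Guard.Holds]; omega⟩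
  | and g h ihg ihh =>
    intro s hs hW
    obtain ⟨t, x, e, ht, hx⟩ := ihg s hs ((Nat.mul_le_mul_right _
      (by simp only [Guard.bound]; omega)).trans hW)
    by_cases h0 : x = 0
    · refine ⟨_, x, .seq e (.cond_false (by simpa using h0) (.skip _)), ?_, ?_⟩
      · simp only [Guard.cost]; omega
      · simp only [Guard.Holds]; tauto
    · obtain ⟨t', x', e', ht', hx'⟩ := ihh (s.setReg 12 x) (hs.setReg le_rfl)
        ((Nat.mul_le_mul_right _ (by simp only [Guard.bound]; omega)).trans hW)
      rw [setReg_setReg] at e'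
      refine ⟨_, x', .seq e (.cond_true (by simpa using h0) e'), ?_, ?_⟩
      · simp only [Guard.cost]; omega
      · simp only [Guard.Holds]; tauto
  | or g h ihg ihh =>
    intro s hs hW
    obtain ⟨t, x, e, ht, hx⟩ := ihg s hs ((Nat.mul_le_mul_right _
      (by simp only [Guard.bound]; omega)).trans hW)
    by_cases h0 : x = 0
    · obtain ⟨t', x', e', ht', hx'⟩ := ihh (s.setReg 12 x) (hs.setReg le_rfl)
        ((Nat.mul_le_mul_right _ (by simp only [Guard.bound]; omega)).trans hW)
      rw [setReg_setReg] at e'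
      refine ⟨_, x', .seq e (.cond_false (by simpa using h0) e'), ?_, ?_⟩
      · simp only [Guard.cost]; omega
      · simp only [Guard.Holds]; tauto
    · refine ⟨_, x, .seq e (.cond_true (by simpa using h0) (.skip _)), ?_, ?_⟩
      · simp only [Guard.cost]; omega
      · simp only [Guard.Holds]; tauto
  | not g ih =>
    intro s hs hW
    obtain ⟨t, x, e, ht, hx⟩ := ih s hs hW
    have hW1 : 1 < W := by
      have : 3 * 1 ≤ (g.bound + 3) * n ^ 5 := Nat.mul_le_mul (by omega) (by omega)
      simp only [Guard.bound] at hW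
      omega
    by_cases h0 : x = 0
    · have e' := Exec.const (W := W) (s.setReg 12 x) 12 1 hW1
      rw [setReg_setReg] at e'
      refine ⟨_, 1, .seq e (.cond_false (by simpa using h0) e'), ?_, ?_⟩
      · simp only [Guard.cost]; omega
      · simp only [Guard.Holds]; tauto
    · have e' := Exec.const (W := W) (s.setReg 12 x) 12 0 (by omega)
      rw [setReg_setReg] at e'
      refine ⟨_, 0, .seq e (.cond_true (by simpa using h0) e'), ?_, ?_⟩
      · simp only [Guard.cost]; omega
      · simp only [Guard.Holds]; tauto

/-- Repeat `P` as often as register 0 says, counting down in register `r`. -/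
def forLoop (r : ℕ) (P : Prog) : Prog :=
  -- Register 3 holds variable 2, which is kept at zero, so the addition copies register 0.
  .seq (.add r 0 3) (.loop r (.seq (.const 13 1) (.seq (.sub r r 13) P)))

theorem exec_loop {W r T : ℕ} {P : Prog} (Inv : ℕ → State → Prop) (hW : 1 < W) (hr : r ≠ 13)
    (hreg : ∀ j s, Inv j s → s.reg r = j)
    (hstep : ∀ j s, Inv (j + 1) s →
      ∃ t s', Exec W P ((s.setReg 13 1).setReg r j) t s' ∧ t ≤ T ∧ Inv j s') :
    ∀ j s, Inv j s → ∃ t s', Exec W (.loop r (.seq (.const 13 1) (.seq (.sub r r 13) P))) s t s' ∧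
      t ≤ j * (T + 3) + 1 ∧ Inv 0 s' := by
  intro j
  induction j with
  | zero =>
    intro s hs
    exact ⟨1, s, .loop_done (hreg 0 s hs), by omega, hs⟩
  | succ j ih =>
    intro s hs
    obtain ⟨t, s', e, ht, hs'⟩ := hstep j s hs
    obtain ⟨t', s'', e', ht', hs''⟩ := ih s' hs'
    have h1 := hreg _ s hs
    have e2 := Exec.sub (W := W) (s.setReg 13 1) r r 13
    rw [setReg_reg_self, setReg_reg_of_ne hr, h1, Nat.add_sub_cancel] at e2
    refine ⟨_, s'', .loop_next (by omega) (.seq (.const s 13 1 hW) (.seq e2 e)) e', ?_, hs''⟩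
    rw [Nat.succ_mul]
    omega

theorem exec_forLoop {W r T : ℕ} {P : Prog} {s : State} (Inv : ℕ → State → Prop) (hn : 0 < n)
    (hW : n < W) (hW1 : 1 < W) (hr : r ≠ 13) (h0 : s.reg 0 = n) (h3 : s.reg 3 = 0)
    (hreg : ∀ j s, Inv j s → s.reg r = j)
    (hstep : ∀ j s, Inv (j + 1) s →
      ∃ t s', Exec W P ((s.setReg 13 1).setReg r j) t s' ∧ t ≤ T ∧ Inv j s')
    (hs : Inv n (s.setReg r n)) :
    ∃ t s', Exec W (forLoop r P) s t s' ∧ t ≤ n * (T + 5) ∧ Inv 0 s' := by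
  obtain ⟨t, s', e, ht, hs'⟩ := exec_loop Inv hW1 hr hreg hstep n _ hs
  have e1 := Exec.add (W := W) s r 0 3 (by omega)
  rw [h0, h3, add_zero] at e1
  refine ⟨_, s', .seq e1 e, ?_, hs'⟩
  have : n * (T + 5) = n * (T + 3) + n * 2 := by ring
  omega

end WordRAM

/-! ### Computing one relation as a least fixed point. -/

namespace WordRAM

variable {n : ℕ}

/-- The rule "if `guard` then `head`", for all values of the variables 3 to 10. -/
structure Rule where
  guard : Guard
  head : Fin 5 → Fin 11

namespace Rule

def fact (c : Rule) (ρ : Fin 11 → Fin n) : Fin 5 → Fin n := fun i => ρ (c.head i)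

/-- `c` as a rule for the relation `k` is applicable if this relation is `X`. -/
def Fires (c : Rule) (E : DB n) (k : ℕ) (X : Set (Fin 5 → Fin n)) (ρ : Fin 11 → Fin n) : Prop :=
  c.guard.Holds (Function.update E k X) ρ

def Closed (c : Rule) (E : DB n) (k : ℕ) (R : Set (Fin 11 → Fin n)) (X : Set (Fin 5 → Fin n)) :
    Prop :=
  ∀ ρ ∈ R, c.Fires E k X ρ → c.fact ρ ∈ X

/-- Guards are evaluated while the relation is still growing. Quantifying over all `Y ⊆ X` replaces
a monotonicity requirement on guards, which may contain negations. -/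
def StronglyClosed (c : Rule) (E : DB n) (k : ℕ) (R : Set (Fin 11 → Fin n))
    (X : Set (Fin 5 → Fin n)) : Prop :=
  ∀ ρ ∈ R, ∀ Y ⊆ X, c.Fires E k Y ρ → c.fact ρ ∈ X

/-- Some applications of the rule, among them those for all valuations in `R`, lead from `X` to
`X'`; `S` is the set of all valuations. -/
structure Advance (c : Rule) (E : DB n) (k : ℕ) (S : Set (Fin 11 → Fin n))
    (X X' : Set (Fin 5 → Fin n)) (R : Set (Fin 11 → Fin n)) : Prop where
  subset : X ⊆ X'
  bounded : ∀ I, c.StronglyClosed E k S I → X ⊆ I → X' ⊆ I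
  stable : c.Closed E k S X → X' = X
  -- If nothing was added, all guards were tested against the same relation.
  closed : X' = X → c.Closed E k R X

variable {c : Rule} {E : DB n} {k : ℕ} {S R R' : Set (Fin 11 → Fin n)}
  {X X' X'' : Set (Fin 5 → Fin n)}

theorem Advance.refl : c.Advance E k S X X ∅ :=
  ⟨subset_rfl, fun _ _ h => h, fun _ => rfl, fun _ _ h => h.elim⟩

theorem Advance.mono (h : c.Advance E k S X X' R) (hR : R' ⊆ R) : c.Advance E k S X X' R' :=
  ⟨h.subset, h.bounded, h.stable, fun he ρ hρ => h.closed he ρ (hR hρ)⟩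

theorem Advance.trans (h : c.Advance E k S X X' R) (h' : c.Advance E k S X' X'' R') :
    c.Advance E k S X X'' (R ∪ R') where
  subset := h.subset.trans h'.subset
  bounded := fun I hI hX => h'.bounded I hI (h.bounded I hI hX)
  stable := fun hc => by
    have := h.stable hc
    subst this
    exact h'.stable hc
  closed := fun he => by
    have e1 : X' = X := (h'.subset.trans he.subset).antisymm h.subset
    subst e1
    rintro ρ (hρ | hρ)
    · exact h.closed rfl ρ hρ
    · exact h'.closed he ρ hρ

def body (c : Rule) (k : ℕ) : Prog :=
  .seq c.guard.prog (.cond 12 (.seq (addr k c.head) (.seq (.const 13 1) (.store 12 13))) .skip)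

/-- Word size that suffices for the rule. -/
def size (c : Rule) (k : ℕ) : ℕ := c.guard.bound + k + 3

theorem exec_body {W : ℕ} {s : State} {ρ : Fin 11 → Fin n}
    (h : Rep s (Function.update E k X) ρ) (hρ : ρ ∈ S) (hW : c.size k * n ^ 5 ≤ W) :
    ∃ t s' X', Exec W (c.body k) s t s' ∧ t ≤ c.guard.cost + 15 ∧
      Rep s' (Function.update E k X') ρ ∧ (∀ r, 14 ≤ r → s'.reg r = s.reg r) ∧
      c.Advance E k S X X' {ρ} := by
  have hn : 0 < n := (Nat.zero_le _).trans_lt (ρ 0).2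
  obtain ⟨t, x, e, ht, hx⟩ := c.guard.exec_prog (W := W) s h
    ((Nat.mul_le_mul_right _ (by simp only [size]; omega)).trans hW)
  by_cases h0 : x = 0
  · refine ⟨_, _, X, .seq e (.cond_false (by simpa using h0) (.skip _)), by omega,
      h.setReg le_rfl, fun r hr => setReg_reg_of_ne (by omega), subset_rfl, fun _ _ h => h,
      fun _ => rfl, ?_⟩
    rintro - ρ' rfl hf
    exact (hx.2 hf h0).elim
  · have hfire : c.Fires E k X ρ := hx.1 h0
    have e1 := exec_addr (k := k) (W := W) (h.setReg (z := 12) (a := x) le_rfl) c.head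
      ((Nat.mul_le_mul_right _ (by simp only [size]; omega)).trans hW)
    rw [setReg_setReg] at e1
    set a := code n k fun i => ρ (c.head i) with ha
    have hW1 : 1 < W := by
      have : 3 * 1 ≤ c.size k * n ^ 5 :=
        Nat.mul_le_mul (by simp only [size]; omega) (Nat.pow_pos hn)
      omega
    have e2 := Exec.const (W := W) (s.setReg 12 a) 13 1 hW1
    have e3 := Exec.store (W := W) ((s.setReg 12 a).setReg 13 1) 12 13
    rw [setReg_reg_self, setReg_reg_of_ne (by omega), setReg_reg_self] at e3
    refine ⟨_, _, insert (c.fact ρ) X, .seq e (.cond_true (by simpa using h0)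
      (.seq e1 (.seq e2 e3))), by omega, ?_, ?_, Set.subset_insert _ _, ?_, ?_, ?_⟩
    · have h' : Rep ((s.setReg 12 a).setReg 13 1) (Function.update E k X) ρ :=
        (h.setReg (by omega)).setReg (by omega)
      refine ⟨h'.size, h'.var, ?_, ?_⟩
      · intro k' t' ht'
        simp only [State.setMem]
        by_cases he : code n k' t' = a
        · rw [he, Function.update_self]
        · rw [Function.update_of_ne he]
          refine h'.mem_of_mem k' t' ?_
          by_cases hk : k' = k
          · subst hk
            rw [Function.update_self] at ht' ⊢
            rcases ht' with rfl | ht'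
            · exact (he rfl).elim
            · exact ht'
          · rwa [Function.update_of_ne hk] at ht' ⊢
      · intro k' t' ht'
        simp only [State.setMem]
        have he : code n k' t' ≠ a := by
          intro he
          obtain ⟨rfl, rfl⟩ := code_inj he
          rw [Function.update_self] at ht'
          exact ht' (Set.mem_insert _ _)
        rw [Function.update_of_ne he]
        refine h'.mem_of_not_mem k' t' ?_
        by_cases hk : k' = k
        · subst hk
          rw [Function.update_self] at ht' ⊢
          exact fun h => ht' (Set.mem_insert_of_mem _ h)
        · rwa [Function.update_of_ne hk] at ht' ⊢
    · intro r hr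
      simp only [State.setMem]
      rw [setReg_reg_of_ne (by omega), setReg_reg_of_ne (by omega)]
    · exact fun I hI hX => Set.insert_subset (hI ρ hρ X hX hfire) hX
    · exact fun hc => Set.insert_eq_of_mem (hc ρ hρ hfire)
    · rintro he ρ' rfl -
      rw [← he]
      exact Set.mem_insert _ _

/-- Valuations with the prescribed values of the variables 0, 1, 2. -/
def valuations (u v : Fin n) : Set (Fin 11 → Fin n) := {ρ | ρ 0 = u ∧ ρ 1 = v ∧ (ρ 2 : ℕ) = 0}

/-- Valuations that differ from `ρ` only in the variables `3, …, q + 2`. -/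
def variants (q : ℕ) (ρ : Fin 11 → Fin n) : Set (Fin 11 → Fin n) :=
  {ρ' | ∀ j : Fin 11, ((j : ℕ) < 3 ∨ 3 + q ≤ j) → ρ' j = ρ j}

theorem variants_subset {u v : Fin n} {ρ : Fin 11 → Fin n} (h : ρ ∈ valuations u v) (q : ℕ) :
    variants q ρ ⊆ valuations u v := fun ρ' hρ' => by
  have h0 := hρ' 0 (.inl (by decide))
  have h1 := hρ' 1 (.inl (by decide))
  have h2 := hρ' 2 (.inl (by decide))
  exact ⟨h0.trans h.1, h1.trans h.2.1, h2 ▸ h.2.2⟩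

/-- Apply the rule for all values of the variables `3, …, q + 2`. -/
def sweep (c : Rule) (k : ℕ) : ℕ → Prog
  | 0 => c.body k
  | q + 1 => forLoop (14 + q) (.seq (.add (4 + q) (14 + q) 3) (c.sweep k q))

theorem _root_.WordRAM.Rep.update_var {s : State} {A : DB n} {ρ : Fin 11 → Fin n}
    (h : Rep s A ρ) (j : Fin 11) (x : Fin n) : Rep (s.setReg (j + 1) x) A (Function.update ρ j x) where
  size := by rw [setReg_reg_of_ne (by omega), h.size]
  var := fun i => by
    by_cases hi : i = j
    · subst hi; simp
    · rw [setReg_reg_of_ne (by omega), Function.update_of_ne hi, h.var]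
  mem_of_mem := h.mem_of_mem
  mem_of_not_mem := h.mem_of_not_mem

theorem size_lt {W : ℕ} (hn : 0 < n) (hW : c.size k * n ^ 5 ≤ W) : n < W ∧ 1 < W := by
  have hn5 : n ≤ n ^ 5 := Nat.le_self_pow (by omega) n
  have h1 : 3 * n ^ 5 ≤ c.size k * n ^ 5 := Nat.mul_le_mul_right _ (by simp only [size]; omega)
  omega

theorem exec_sweep {W : ℕ} {u v : Fin n} (hW : c.size k * n ^ 5 ≤ W) {q : ℕ} (hq : q ≤ 8) :
    ∀ (s : State) (X : Set (Fin 5 → Fin n)) (ρ : Fin 11 → Fin n), ρ ∈ valuations u v →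
    Rep s (Function.update E k X) ρ →
    ∃ t s' X' ρ', Exec W (c.sweep k q) s t s' ∧ t ≤ n ^ q * (c.guard.cost + 15 + 6 * q) ∧
      Rep s' (Function.update E k X') ρ' ∧ ρ' ∈ variants q ρ ∧
      (∀ r, 14 + q ≤ r → s'.reg r = s.reg r) ∧
      c.Advance E k (valuations u v) X X' (variants q ρ) := by
  have hn : 0 < n := (Nat.zero_le _).trans_lt u.2
  obtain ⟨hnW, hW1⟩ := size_lt hn hW
  induction q with
  | zero =>
    intro s X ρ hρ h
    obtain ⟨t, s', X', e, ht, hs', hr, hA⟩ := exec_body h hρ hW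
    refine ⟨t, s', X', ρ, e, by simpa using ht, hs', fun _ _ => rfl, hr, hA.mono ?_⟩
    intro ρ' hρ'
    exact funext fun j => hρ' j (by omega)
  | succ q ih =>
    intro s₀ X₀ ρ₀ hρ₀ h₀
    set j₀ : Fin 11 := ⟨3 + q, by omega⟩ with hj₀
    -- The counter runs downwards, so the values from `j` on of variable `3 + q` are done. Higher
    -- registers must be preserved for the enclosing loops.
    let Inv : ℕ → State → Prop := fun j s => j ≤ n ∧ s.reg (14 + q) = j ∧
      (∀ r, 14 + (q + 1) ≤ r → s.reg r = s₀.reg r) ∧ ∃ X ρ, Rep s (Function.update E k X) ρ ∧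
        ρ ∈ variants (q + 1) ρ₀ ∧
        c.Advance E k (valuations u v) X₀ X {ρ' ∈ variants (q + 1) ρ₀ | j ≤ (ρ' j₀ : ℕ)}
    have hstep : ∀ j s, Inv (j + 1) s → ∃ t s', Exec W (.seq (.add (4 + q) (14 + q) 3) (c.sweep k q))
        ((s.setReg 13 1).setReg (14 + q) j) t s' ∧
        t ≤ n ^ q * (c.guard.cost + 15 + 6 * q) + 1 ∧ Inv j s' := by
      rintro j s ⟨hjn, hreg, hfr, X, ρ, hs, hρ, hA⟩
      set s1 := (s.setReg 13 1).setReg (14 + q) j with hs1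
      have hr1 : Rep s1 (Function.update E k X) ρ := (hs.setReg (by omega)).setReg (by omega)
      have hρS := variants_subset hρ₀ _ hρ
      have hz : s1.reg 3 = 0 := by have := hr1.var 2; rw [hρS.2.2] at this; exact this
      have hc : s1.reg (14 + q) = j := setReg_reg_self ..
      have e1 := Exec.add (W := W) s1 (4 + q) (14 + q) 3 (by rw [hc, hz]; omega)
      rw [hc, hz, add_zero] at e1
      have hr2 := hr1.update_var j₀ ⟨j, by omega⟩
      rw [show (j₀ : ℕ) + 1 = 4 + q by rw [hj₀]; simp only; omega] at hr2
      set ρ1 := Function.update ρ j₀ ⟨j, by omega⟩ with hρ1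
      have hρ1v : ρ1 ∈ variants (q + 1) ρ₀ := fun i hi => by
        rw [hρ1, Function.update_of_ne, hρ i hi]
        rintro rfl
        simp only [hj₀] at hi
        omega
      obtain ⟨t, s', X', ρ', e, ht, hs', hρ', hr, hA'⟩ := ih (by omega) _ _ _
        (variants_subset hρ₀ _ hρ1v) hr2
      have hj1 : ∀ ρ' ∈ variants q ρ1, ρ' ∈ variants (q + 1) ρ₀ := fun ρ' hρ' i hi => by
        rw [hρ' i (by omega), hρ1v i hi]
      refine ⟨_, s', .seq e1 e, by omega, by omega, ?_, ?_, X', ρ', hs', hj1 _ hρ', ?_⟩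
      · rw [hr _ le_rfl, setReg_reg_of_ne (by omega), hc]
      · intro r hr'
        rw [hr _ (by omega), setReg_reg_of_ne (by omega), hs1, setReg_reg_of_ne (by omega),
          setReg_reg_of_ne (by omega), hfr r hr']
      · refine (hA.trans hA').mono ?_
        rintro ρ'' ⟨h1, h2⟩
        rcases h2.eq_or_lt with h2 | h2
        · refine .inr fun i hi => ?_
          by_cases hij : i = j₀
          · subst hij
            rw [hρ1, Function.update_self]
            exact Fin.ext h2.symm
          · have hi' : (i : ℕ) ≠ 3 + q := fun h => hij (Fin.ext h)
            rw [h1 i (by omega), hρ1v i (by omega)]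
        · exact .inl ⟨h1, h2⟩
    have hinit : Inv n (s₀.setReg (14 + q) n) := by
      refine ⟨le_rfl, setReg_reg_self .., fun r hr => setReg_reg_of_ne (by omega), X₀, ρ₀,
        h₀.setReg (by omega), fun _ _ => rfl, Advance.refl.mono ?_⟩
      rintro ρ ⟨-, h⟩
      have := (ρ j₀).2
      omega
    obtain ⟨t, s', e, ht, -, -, hr, X', ρ', hs', hρ', hA⟩ := exec_forLoop Inv hn hnW hW1
      (by omega) h₀.size (by have := h₀.var 2; rw [hρ₀.2.2] at this; exact this)
      (fun j s h => h.2.1) hstep hinit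
    refine ⟨t, s', X', ρ', e, ht.trans ?_, hs', hρ', hr, hA.mono fun ρ hρ => ⟨hρ, Nat.zero_le _⟩⟩
    have h1 : 1 ≤ n ^ q := Nat.pow_pos hn
    have h2 : n ^ (q + 1) = n * n ^ q := by rw [pow_succ, mul_comm]
    rw [h2, mul_assoc]
    refine Nat.mul_le_mul_left _ ?_
    nlinarith

/-- The effect of `N` sweeps. -/
structure Grown (c : Rule) (E : DB n) (k : ℕ) (S : Set (Fin 11 → Fin n))
    (X X' : Set (Fin 5 → Fin n)) (N : ℕ) : Prop where
  subset : X ⊆ X'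
  bounded : ∀ I, c.StronglyClosed E k S I → X ⊆ I → X' ⊆ I
  stable : c.Closed E k S X → X' = X
  grows : c.Closed E k S X' ∨ X.ncard + N ≤ X'.ncard

theorem Grown.refl : c.Grown E k S X X 0 :=
  ⟨subset_rfl, fun _ _ h => h, fun _ => rfl, .inr le_rfl⟩

theorem Grown.trans {N N' : ℕ} (h : c.Grown E k S X X' N) (h' : c.Grown E k S X' X'' N') :
    c.Grown E k S X X'' (N + N') where
  subset := h.subset.trans h'.subset
  bounded := fun I hI hX => h'.bounded I hI (h.bounded I hI hX)
  stable := fun hc => by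
    have := h.stable hc
    subst this
    exact h'.stable hc
  grows := by
    rcases h.grows with hc | hN
    · have := h'.stable hc
      subst this
      exact .inl hc
    · exact h'.grows.imp_right fun hN' => by omega

theorem Advance.grown (h : c.Advance E k S X X' S) : c.Grown E k S X X' 1 where
  subset := h.subset
  bounded := h.bounded
  stable := h.stable
  grows := by
    by_cases he : X' = X
    · have := h.closed he
      subst he
      exact .inl this
    · exact .inr (Set.ncard_lt_ncard (h.subset.ssubset_of_ne (Ne.symm he)) (Set.toFinite _))

/-- Make `n ^ q` sweeps. -/
def rounds (c : Rule) (k : ℕ) : ℕ → Prog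
  | 0 => c.sweep k 8
  | q + 1 => forLoop (22 + q) (c.rounds k q)

theorem exec_rounds {W : ℕ} {u v : Fin n} (hW : c.size k * n ^ 5 ≤ W) (q : ℕ) :
    ∀ (s : State) (X : Set (Fin 5 → Fin n)) (ρ : Fin 11 → Fin n), ρ ∈ valuations u v →
    Rep s (Function.update E k X) ρ →
    ∃ t s' X' ρ', Exec W (c.rounds k q) s t s' ∧ t ≤ n ^ (8 + q) * (c.guard.cost + 63 + 5 * q) ∧
      Rep s' (Function.update E k X') ρ' ∧ ρ' ∈ valuations u v ∧
      (∀ r, 22 + q ≤ r → s'.reg r = s.reg r) ∧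
      c.Grown E k (valuations u v) X X' (n ^ q) := by
  have hn : 0 < n := (Nat.zero_le _).trans_lt u.2
  obtain ⟨hnW, hW1⟩ := size_lt hn hW
  induction q with
  | zero =>
    intro s X ρ hρ h
    obtain ⟨t, s', X', ρ', e, ht, hs', hρ', hr, hA⟩ := exec_sweep (q := 8) hW le_rfl s X ρ hρ h
    refine ⟨t, s', X', ρ', e, ht, hs', variants_subset hρ _ hρ', hr, (hA.mono ?_).grown⟩
    intro ρ'' hρ'' j hj
    have hj' : (j : ℕ) < 3 := hj.resolve_right (by omega)
    obtain rfl | rfl | rfl : j = 0 ∨ j = 1 ∨ j = 2 := by omega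
    · rw [hρ''.1, hρ.1]
    · rw [hρ''.2.1, hρ.2.1]
    · exact Fin.ext (by rw [hρ''.2.2, hρ.2.2])
  | succ q ih =>
    intro s₀ X₀ ρ₀ hρ₀ h₀
    let Inv : ℕ → State → Prop := fun j s => j ≤ n ∧ s.reg (22 + q) = j ∧
      (∀ r, 22 + (q + 1) ≤ r → s.reg r = s₀.reg r) ∧ ∃ X ρ, Rep s (Function.update E k X) ρ ∧
        ρ ∈ valuations u v ∧ c.Grown E k (valuations u v) X₀ X ((n - j) * n ^ q)
    have hstep : ∀ j s, Inv (j + 1) s → ∃ t s', Exec W (c.rounds k q)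
        ((s.setReg 13 1).setReg (22 + q) j) t s' ∧
        t ≤ n ^ (8 + q) * (c.guard.cost + 63 + 5 * q) ∧ Inv j s' := by
      rintro j s ⟨hjn, hreg, hfr, X, ρ, hs, hρ, hA⟩
      obtain ⟨t, s', X', ρ', e, ht, hs', hρ', hr, hA'⟩ := ih
        ((s.setReg 13 1).setReg (22 + q) j) X ρ hρ ((hs.setReg (by omega)).setReg (by omega))
      refine ⟨t, s', e, ht, by omega, ?_, ?_, X', ρ', hs', hρ', ?_⟩
      · rw [hr _ le_rfl, setReg_reg_self]
      · intro r hr'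
        rw [hr _ (by omega), setReg_reg_of_ne (by omega), setReg_reg_of_ne (by omega), hfr r hr']
      · have h1 : (n - j) * n ^ q = (n - (j + 1)) * n ^ q + n ^ q := by
          rw [show n - j = n - (j + 1) + 1 by omega, Nat.succ_mul]
        rw [h1]
        exact hA.trans hA'
    have hinit : Inv n (s₀.setReg (22 + q) n) := by
      refine ⟨le_rfl, setReg_reg_self .., fun r hr => setReg_reg_of_ne (by omega), X₀, ρ₀,
        h₀.setReg (by omega), hρ₀, ?_⟩
      rw [Nat.sub_self, zero_mul]
      exact Grown.refl
    obtain ⟨t, s', e, ht, -, -, hr, X', ρ', hs', hρ', hA⟩ := exec_forLoop Inv hn hnW hW1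
      (by omega) h₀.size (by have := h₀.var 2; rw [hρ₀.2.2] at this; exact this)
      (fun j s h => h.2.1) hstep hinit
    refine ⟨t, s', X', ρ', e, ht.trans ?_, hs', hρ', hr, ?_⟩
    · have h1 : 1 ≤ n ^ (8 + q) := Nat.pow_pos hn
      have h2 : n ^ (8 + (q + 1)) = n * n ^ (8 + q) := by rw [← add_assoc, pow_succ, mul_comm]
      rw [h2, mul_assoc]
      refine Nat.mul_le_mul_left _ ?_
      nlinarith
    · rwa [Nat.sub_zero, ← pow_succ'] at hA

/-- The relation `X` is the least one that is closed under the rule. -/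
def Derives (c : Rule) (E : DB n) (k : ℕ) (S : Set (Fin 11 → Fin n))
    (X : Set (Fin 5 → Fin n)) : Prop :=
  c.Closed E k S X ∧ ∀ I, c.StronglyClosed E k S I → X ⊆ I

/-- There are `n ^ 5` tuples, so a relation that grew in each of `n ^ 5` sweeps is full and
trivially closed. -/
theorem Grown.derives (h : c.Grown E k S ∅ X (n ^ 5)) : c.Derives E k S X := by
  refine ⟨?_, fun I hI => h.bounded I hI (Set.empty_subset _)⟩
  rcases h.grows with hc | hN
  · exact hc
  · have : X = Set.univ := by
      refine Set.eq_of_subset_of_ncard_le (Set.subset_univ _) ?_ (Set.toFinite _)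
      rw [Set.ncard_univ, Nat.card_eq_fintype_card, Fintype.card_fun, Fintype.card_fin,
        Fintype.card_fin]
      omega
    subst this
    exact fun _ _ _ => trivial

end Rule

end WordRAM

/-! ### The rules and the relations they are meant to define. -/

namespace WordRAM

open Relation

variable {n : ℕ}

/-- The first `k` relations of `A`. -/
def stage (A : DB n) (k : ℕ) : DB n := fun j => if j < k then A j else ∅

theorem update_stage (A : DB n) (k : ℕ) : Function.update (stage A k) k (A k) = stage A (k + 1) := by
  funext j
  by_cases hj : j = k
  · subst hj; simp [stage]
  · rw [Function.update_of_ne hj]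
    simp only [stage]
    congr 1
    simp only [eq_iff_iff]
    omega

/-- Compute the relations `k, k + 1, …`. -/
def runRules : ℕ → List Rule → Prog
  | _, [] => .skip
  | k, c :: cs => .seq (c.rounds k 5) (runRules (k + 1) cs)

def rulesSize : ℕ → List Rule → ℕ
  | _, [] => 0
  | k, c :: cs => c.size k + rulesSize (k + 1) cs

def rulesCost : List Rule → ℕ
  | [] => 1
  | c :: cs => c.guard.cost + 88 + rulesCost cs

/-- The rules define the relations `A k, A (k + 1), …`. -/
def Define (A : DB n) (S : Set (Fin 11 → Fin n)) : ℕ → List Rule → Prop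
  | _, [] => True
  | k, c :: cs => (∀ X, c.Derives (stage A k) k S X → X = A k) ∧ Define A S (k + 1) cs

theorem exec_runRules {W : ℕ} {u v : Fin n} {A : DB n} (cs : List Rule) :
    ∀ (k : ℕ) (s : State) (ρ : Fin 11 → Fin n), rulesSize k cs * n ^ 5 ≤ W →
    Define A (Rule.valuations u v) k cs → ρ ∈ Rule.valuations u v → Rep s (stage A k) ρ →
    ∃ t s' ρ', Exec W (runRules k cs) s t s' ∧ t ≤ n ^ 13 * rulesCost cs ∧
      ρ' ∈ Rule.valuations u v ∧ Rep s' (stage A (k + cs.length)) ρ' := by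
  have hn : 0 < n := (Nat.zero_le _).trans_lt u.2
  induction cs with
  | nil =>
    intro k s ρ _ _ hρ hs
    exact ⟨1, s, ρ, .skip s, by simpa [rulesCost] using Nat.one_le_pow _ _ hn, hρ, by simpa using hs⟩
  | cons c cs ih =>
    intro k s ρ hW hD hρ hs
    have hs' : Rep s (Function.update (stage A k) k ∅) ρ := by
      rwa [show Function.update (stage A k) k ∅ = stage A k from
        Function.update_eq_self_iff.2 (by simp [stage])]
    obtain ⟨t, s', X, ρ', e, ht, hs', hρ', -, hG⟩ := c.exec_rounds (W := W)
      ((Nat.mul_le_mul_right _ (by simp only [rulesSize]; omega)).trans hW) 5 s ∅ ρ hρ hs'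
    obtain rfl := hD.1 X hG.derives
    rw [update_stage] at hs'
    obtain ⟨t', s'', ρ'', e', ht', hρ'', hs''⟩ := ih (k + 1) s' ρ'
      ((Nat.mul_le_mul_right _ (by simp only [rulesSize]; omega)).trans hW) hD.2 hρ' hs'
    refine ⟨_, s'', ρ'', .seq e e', ?_, hρ'', ?_⟩
    · calc t + t' ≤ n ^ (8 + 5) * (c.guard.cost + 63 + 5 * 5) + n ^ 13 * rulesCost cs :=
            Nat.add_le_add ht ht'
        _ = n ^ 13 * rulesCost (c :: cs) := by simp only [rulesCost]; ring
    · rwa [List.length_cons, show k + (cs.length + 1) = k + 1 + cs.length by omega]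

namespace Guard

/-- Variable 2 is zero; with three leading zeros the address becomes that of an entry of the input
adjacency matrix. -/
def edge (x y : Fin 11) : Guard := rel 0 ![2, 2, 2, x, y]
def eq (x y : Fin 11) : Guard := and (lt x y 2 1) (lt y x 2 1)
def succ (x y : Fin 11) : Guard := and (lt x y 2 0) (lt y x 2 2)
-- A walk of length `l` and none shorter. The negation is sound because relation 2 is complete
-- before this guard is used.
def dist (s x l : Fin 11) : Guard := and (rel 1 ![s, l, x, 2, 2]) (not (rel 2 ![s, l, x, 2, 2]))
def up (x y : Fin 11) : Guard := rel 3 ![x, y, 2, 2, 2]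
def sameDist (x y : Fin 11) : Guard := rel 4 ![x, y, 2, 2, 2]
def ltDist (x y : Fin 11) : Guard := rel 5 ![x, y, 2, 2, 2]

def apart (x y : Fin 11) : Guard :=
  and (not (eq x y)) (and (not (edge x y)) (or (eq x 3) (and (not (eq x 4)) (not (edge x 4)))))

def pairStep : Guard :=
  and (apart 8 9) (and (not (edge 6 9)) (and (not (edge 8 7))
    (or (and (up 6 8) (and (up 7 9) (sameDist 6 7)))
      (or (and (up 6 8) (and (eq 7 9) (and (eq 7 5) (ltDist 6 7))))
        (and (eq 6 8) (and (eq 6 3) (up 7 9)))))))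

end Guard

section

open Guard

/-- Unused coordinates of a head are free variables, so a fact is derived with every padding and may
be read with any. -/
def walkRule : Rule :=
  ⟨or (and (eq 3 7) (lt 5 2 2 1)) (and (rel 1 ![3, 4, 6, 2, 2]) (and (edge 7 6) (succ 4 5))),
    ![3, 5, 7, 8, 9]⟩

def shorterWalkRule : Rule := ⟨and (rel 1 ![3, 4, 6, 2, 2]) (lt 4 5 2 0), ![3, 5, 6, 7, 8]⟩

def upRule : Rule :=
  ⟨and (edge 3 4) (and (dist 0 3 5) (and (dist 0 4 6) (succ 5 6))), ![3, 4, 7, 8, 9]⟩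

def sameDistRule : Rule := ⟨and (dist 0 3 5) (dist 0 4 5), ![3, 4, 7, 8, 9]⟩

def ltDistRule : Rule :=
  ⟨and (dist 0 3 5) (and (dist 0 4 6) (lt 5 6 2 0)), ![3, 4, 7, 8, 9]⟩

def turnRule : Rule :=
  ⟨and (dist 0 3 5) (and (dist 1 4 6) (and (dist 0 1 7) (lt 7 5 6 1))), ![3, 4, 8, 9, 10]⟩

def pairFwdRule : Rule :=
  ⟨or (and (and (apart 0 5) (ltDist 0 5)) (and (eq 8 0) (eq 9 5)))
    (and (rel 7 ![3, 4, 5, 6, 7]) pairStep), ![3, 4, 5, 8, 9]⟩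

/-- Searches backwards from `(a, v)` among the pairs already known to be reachable forwards. -/
def pairMidRule : Rule :=
  ⟨and (rel 7 ![3, 4, 5, 6, 7]) (or (and (eq 6 3) (eq 7 1))
    (and pairStep (rel 8 ![3, 4, 5, 8, 9]))), ![3, 4, 5, 6, 7]⟩

def blockedRule : Rule :=
  ⟨and (rel 8 ![3, 4, 5, 6, 7]) (and (not (eq 6 3)) (or (eq 8 6) (edge 8 6))), ![3, 4, 5, 8, 9]⟩

def linkRule : Rule :=
  ⟨and (not (rel 9 ![3, 4, 5, 7, 2]))
    (or (and (rel 7 ![3, 4, 5, 3, 1]) (and (edge 3 7) (rel 6 ![3, 7, 2, 2, 2])))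
      (and (rel 10 ![3, 4, 5, 6, 2]) (and (edge 6 7) (and (not (edge 7 3)) (not (eq 7 3)))))),
    ![3, 4, 5, 7, 8]⟩

def detourRule : Rule :=
  ⟨and (rel 10 ![3, 4, 5, 4, 2]) (or (eq 4 5) (edge 4 5)), ![6, 7, 8, 9, 10]⟩

end

/-- The rules for the relations 1 to 11. -/
def rules : List Rule :=
  [walkRule, shorterWalkRule, upRule, sameDistRule, ltDistRule, turnRule, pairFwdRule, pairMidRule,
    blockedRule, linkRule, detourRule]

/-- The relations that the rules compute. -/
def relations (G : SimpleGraph (Fin n)) (u v : Fin n) : DB n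
  | 0 => {t | ((t 0 : ℕ) = 0 ∧ (t 1 : ℕ) = 0 ∧ (t 2 : ℕ) = 0) ∧ G.Adj (t 3) (t 4)}
  | 1 => {t | ∃ w : G.Walk (t 2) (t 0), w.length = t 1}
  | 2 => {t | ∃ w : G.Walk (t 2) (t 0), w.length < t 1}
  | 3 => {t | G.Up u (t 0) (t 1)}
  | 4 => {t | G.SameDist u (t 0) (t 1)}
  | 5 => {t | G.LtDist u (t 0) (t 1)}
  | 6 => {t | G.Turn u v (t 0) (t 1)}
  | 7 => {t | G.PairFwd u (t 0) (t 1) (t 2) (t 3) (t 4)}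
  | 8 => {t | G.PairMid u v (t 0) (t 1) (t 2) (t 3) (t 4)}
  | 9 => {t | G.Blocked u v (t 0) (t 1) (t 2) (t 3)}
  | 10 => {t | G.Link u v (t 0) (t 1) (t 2) (t 3)}
  | _ => {_t | G.HasDetour u v}

variable {G : SimpleGraph (Fin n)} {u v : Fin n} {A : DB n} {ρ : Fin 11 → Fin n}

namespace Guard

theorem holds_edge (hρ : ρ ∈ Rule.valuations u v) (hA : A 0 = relations G u v 0) (x y : Fin 11) :
    (edge x y).Holds A ρ ↔ G.Adj (ρ x) (ρ y) := by
  simp only [edge, Holds, hA]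
  change (((ρ 2 : ℕ) = 0 ∧ (ρ 2 : ℕ) = 0 ∧ (ρ 2 : ℕ) = 0) ∧ G.Adj (ρ x) (ρ y)) ↔ _
  simp [hρ.2.2]

theorem holds_eq (hρ : ρ ∈ Rule.valuations u v) (x y : Fin 11) :
    (eq x y).Holds A ρ ↔ ρ x = ρ y := by
  simp only [eq, Holds, hρ.2.2, Fin.ext_iff]
  omega

theorem holds_succ (hρ : ρ ∈ Rule.valuations u v) (x y : Fin 11) :
    (succ x y).Holds A ρ ↔ (ρ y : ℕ) = ρ x + 1 := by
  simp only [succ, Holds, hρ.2.2]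
  omega

theorem holds_dist (h1 : A 1 = relations G u v 1) (h2 : A 2 = relations G u v 2) (s x l : Fin 11) :
    (dist s x l).Holds A ρ ↔ G.Reachable (ρ s) (ρ x) ∧ G.dist (ρ s) (ρ x) = ρ l := by
  simp only [dist, Holds, h1, h2]
  change ((∃ w : G.Walk (ρ x) (ρ s), w.length = ρ l) ∧
    ¬ ∃ w : G.Walk (ρ x) (ρ s), w.length < ρ l) ↔ _
  constructor
  · rintro ⟨⟨w, hw⟩, hmin⟩
    refine ⟨⟨w.reverse⟩, ?_⟩
    have hr : G.Reachable (ρ x) (ρ s) := ⟨w⟩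
    obtain ⟨w', hw'⟩ := hr.exists_walk_length_eq_dist
    have e1 := SimpleGraph.dist_le w
    have e2 : ¬ w'.length < ρ l := fun h => hmin ⟨w', h⟩
    rw [SimpleGraph.dist_comm]
    omega
  · rintro ⟨hr, hd⟩
    obtain ⟨w, hw⟩ := hr.symm.exists_walk_length_eq_dist
    rw [SimpleGraph.dist_comm] at hd
    refine ⟨⟨w, hw.trans hd⟩, ?_⟩
    rintro ⟨w', hw'⟩
    have := SimpleGraph.dist_le w'
    omega

theorem holds_up (h : A 3 = relations G u v 3) (x y : Fin 11) :
    (up x y).Holds A ρ ↔ G.Up u (ρ x) (ρ y) := by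
  simp only [up, Holds, h]; rfl

theorem holds_sameDist (h : A 4 = relations G u v 4) (x y : Fin 11) :
    (sameDist x y).Holds A ρ ↔ G.SameDist u (ρ x) (ρ y) := by
  simp only [sameDist, Holds, h]; rfl

theorem holds_ltDist (h : A 5 = relations G u v 5) (x y : Fin 11) :
    (ltDist x y).Holds A ρ ↔ G.LtDist u (ρ x) (ρ y) := by
  simp only [ltDist, Holds, h]; rfl

theorem holds_apart (hρ : ρ ∈ Rule.valuations u v) (hA : A 0 = relations G u v 0) (x y : Fin 11) :
    (apart x y).Holds A ρ ↔ G.Apart (ρ 3) (ρ 4) (ρ x) (ρ y) := by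
  simp only [apart, Holds, holds_eq hρ, holds_edge hρ hA]; rfl

theorem holds_pairStep (hρ : ρ ∈ Rule.valuations u v) (hA : ∀ j ≤ 5, A j = relations G u v j) :
    pairStep.Holds A ρ ↔ G.PairStep u (ρ 3) (ρ 4) (ρ 5) (ρ 6, ρ 7) (ρ 8, ρ 9) := by
  simp only [pairStep, Holds, holds_eq hρ, holds_edge hρ (hA 0 (by omega)),
    holds_apart hρ (hA 0 (by omega)), holds_up (hA 3 (by omega)), holds_sameDist (hA 4 (by omega)),
    holds_ltDist (hA 5 (by omega))]
  rfl

end Guard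

theorem update_stage_of_lt {k j : ℕ} {Y : Set (Fin 5 → Fin n)} (h : j < k) :
    Function.update (stage A k) k Y j = A j := by
  rw [Function.update_of_ne (by omega), stage, if_pos h]

/-- Allows distances to be values of variables, which range over `Fin n`. -/
theorem fin_dist_lt {x y : Fin n} (h : G.Reachable x y) : G.dist x y < n := by
  obtain ⟨p, hp, hl⟩ := h.exists_path_of_dist
  rw [← hl]
  simpa using hp.length_lt

theorem vec5_eta {α : Type*} (t : Fin 5 → α) : ![t 0, t 1, t 2, t 3, t 4] = t := by
  funext i
  fin_cases i <;> rfl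

end WordRAM

/-! ### Each rule defines its relation. -/

namespace WordRAM

open Relation Guard

variable {n : ℕ} {G : SimpleGraph (Fin n)} {u v : Fin n} {A : DB n} {ρ : Fin 11 → Fin n}
  {X Y : Set (Fin 5 → Fin n)}

theorem comp_vec5 (a b c d e : Fin 11) :
    (fun i => ρ (![a, b, c, d, e] i)) = ![ρ a, ρ b, ρ c, ρ d, ρ e] := by
  funext i
  fin_cases i <;> rfl

namespace Rule

/-- Soundness of the rule for `R` is the first hypothesis, completeness the second. -/
theorem Derives.eq {c : Rule} {E : DB n} {k : ℕ} {S : Set (Fin 11 → Fin n)}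
    {R : Set (Fin 5 → Fin n)} (h : c.Derives E k S X) (h₁ : c.StronglyClosed E k S R)
    (h₂ : c.Closed E k S X → R ⊆ X) : X = R :=
  (h.2 R h₁).antisymm (h₂ h.1)

theorem fact_mk (g : Guard) (a b c d e : Fin 11) :
    (Rule.mk g ![a, b, c, d, e]).fact ρ = ![ρ a, ρ b, ρ c, ρ d, ρ e] := comp_vec5 a b c d e

/-- The valuation with the given values of the variables 3 to 10. -/
def valuation (u v x₃ x₄ x₅ x₆ x₇ x₈ x₉ x₁₀ : Fin n) : Fin 11 → Fin n :=
  ![u, v, ⟨0, (Nat.zero_le _).trans_lt u.2⟩, x₃, x₄, x₅, x₆, x₇, x₈, x₉, x₁₀]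

theorem valuation_mem (u v x₃ x₄ x₅ x₆ x₇ x₈ x₉ x₁₀ : Fin n) :
    valuation u v x₃ x₄ x₅ x₆ x₇ x₈ x₉ x₁₀ ∈ valuations u v := ⟨rfl, rfl, rfl⟩

end Rule

open Rule

theorem fires_walkRule (hρ : ρ ∈ valuations u v) :
    walkRule.Fires (stage (relations G u v) 1) 1 Y ρ ↔
      (ρ 3 = ρ 7 ∧ (ρ 5 : ℕ) = 0 ∨
        ![ρ 3, ρ 4, ρ 6, ρ 2, ρ 2] ∈ Y ∧ G.Adj (ρ 7) (ρ 6) ∧ (ρ 5 : ℕ) = ρ 4 + 1) := by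
  simp only [Fires, walkRule, Holds, holds_eq hρ, holds_succ hρ, hρ.2.2, comp_vec5,
    holds_edge hρ (update_stage_of_lt (A := relations G u v) (show 0 < 1 by omega)),
    Function.update_self, add_zero, zero_add, Nat.lt_one_iff]

theorem walkRule_derives (h : walkRule.Derives (stage (relations G u v) 1) 1 (valuations u v) X) :
    X = relations G u v 1 := by
  refine h.eq (fun ρ hρ Y hY hf => ?_) fun hc t ht => ?_
  · change ∃ w : G.Walk (ρ 7) (ρ 3), w.length = ρ 5
    rcases (fires_walkRule hρ).1 hf with ⟨h1, h2⟩ | ⟨h1, h2, h3⟩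
    · rw [h1]
      exact ⟨.nil, h2.symm⟩
    · obtain ⟨w, hw⟩ : ∃ w : G.Walk (ρ 6) (ρ 3), w.length = ρ 4 := hY h1
      exact ⟨.cons h2 w, by rw [SimpleGraph.Walk.length_cons, hw, h3]⟩
  · have key : ∀ {x y : Fin n} (w : G.Walk x y) (l p q : Fin n), w.length = l →
        ![y, l, x, p, q] ∈ X := by
      intro x y w
      induction w with
      | @nil x =>
        intro l p q hl
        have := hc _ (valuation_mem u v x x l x x p q x)
          ((fires_walkRule (valuation_mem ..)).2 (.inl ⟨rfl, hl.symm⟩))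
        rw [walkRule, fact_mk] at this
        exact this
      | @cons x z y hxz w ih =>
        intro l p q hl
        have hl' : w.length < n := by rw [SimpleGraph.Walk.length_cons] at hl; omega
        have := hc _ (valuation_mem u v y ⟨w.length, hl'⟩ l z x p q x)
          ((fires_walkRule (valuation_mem ..)).2 (.inr ⟨ih _ _ _ rfl, hxz, hl.symm⟩))
        rw [walkRule, fact_mk] at this
        exact this
    obtain ⟨w, hw⟩ := ht
    have := key w (t 1) (t 3) (t 4) hw
    rwa [vec5_eta] at this

theorem fires_shorterWalkRule (hρ : ρ ∈ valuations u v) :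
    shorterWalkRule.Fires (stage (relations G u v) 2) 2 Y ρ ↔
      (∃ w : G.Walk (ρ 6) (ρ 3), w.length = ρ 4) ∧ (ρ 4 : ℕ) < ρ 5 := by
  simp only [Fires, shorterWalkRule, Holds, hρ.2.2, comp_vec5, add_zero,
    update_stage_of_lt (show 1 < 2 by omega)]
  rfl

theorem shorterWalkRule_derives
    (h : shorterWalkRule.Derives (stage (relations G u v) 2) 2 (valuations u v) X) :
    X = relations G u v 2 := by
  refine h.eq (fun ρ hρ Y hY hf => ?_) fun hc t ht => ?_
  · obtain ⟨⟨w, hw⟩, hl⟩ := (fires_shorterWalkRule hρ).1 hf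
    exact ⟨w, hw.trans_lt hl⟩
  · obtain ⟨w, hw⟩ := ht
    have := hc _ (valuation_mem u v (t 0) ⟨w.length, hw.trans (t 1).2⟩ (t 1) (t 2) (t 3) (t 4) u u)
      ((fires_shorterWalkRule (valuation_mem ..)).2 ⟨⟨w, rfl⟩, hw⟩)
    rw [shorterWalkRule, fact_mk] at this
    rw [← vec5_eta t]
    exact this

theorem fires_upRule (hρ : ρ ∈ valuations u v) :
    upRule.Fires (stage (relations G u v) 3) 3 Y ρ ↔ G.Adj (ρ 3) (ρ 4) ∧
      (G.Reachable u (ρ 3) ∧ G.dist u (ρ 3) = ρ 5) ∧ (G.Reachable u (ρ 4) ∧ G.dist u (ρ 4) = ρ 6) ∧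
      (ρ 6 : ℕ) = ρ 5 + 1 := by
  have hA : ∀ j < 3, Function.update (stage (relations G u v) 3) 3 Y j = relations G u v j :=
    fun j => update_stage_of_lt
  simp only [Fires, upRule, Holds, holds_edge hρ (hA 0 (by omega)), holds_succ hρ,
    holds_dist (hA 1 (by omega)) (hA 2 (by omega)), hρ.1]

theorem upRule_derives (h : upRule.Derives (stage (relations G u v) 3) 3 (valuations u v) X) :
    X = relations G u v 3 := by
  refine h.eq (fun ρ hρ Y hY hf => ?_) fun hc t ht => ?_
  · obtain ⟨h1, ⟨h2, h3⟩, ⟨h4, h5⟩, h6⟩ := (fires_upRule hρ).1 hf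
    exact ⟨h1, h2, h5.trans (h6.trans (by rw [← h3]; rfl))⟩
  · obtain ⟨h1, h2, h3⟩ := ht
    have h4 := h2.trans h1.reachable
    have := hc _ (valuation_mem u v (t 0) (t 1) ⟨_, fin_dist_lt h2⟩ ⟨_, fin_dist_lt h4⟩ (t 2) (t 3)
      (t 4) u) ((fires_upRule (valuation_mem ..)).2 ⟨h1, ⟨h2, rfl⟩, ⟨h4, rfl⟩, h3⟩)
    rw [upRule, fact_mk] at this
    rw [← vec5_eta t]
    exact this

theorem fires_sameDistRule (hρ : ρ ∈ valuations u v) :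
    sameDistRule.Fires (stage (relations G u v) 4) 4 Y ρ ↔
      (G.Reachable u (ρ 3) ∧ G.dist u (ρ 3) = ρ 5) ∧
      (G.Reachable u (ρ 4) ∧ G.dist u (ρ 4) = ρ 5) := by
  have hA : ∀ j < 4, Function.update (stage (relations G u v) 4) 4 Y j = relations G u v j :=
    fun j => update_stage_of_lt
  simp only [Fires, sameDistRule, Holds, holds_dist (hA 1 (by omega)) (hA 2 (by omega)), hρ.1]

theorem sameDistRule_derives
    (h : sameDistRule.Derives (stage (relations G u v) 4) 4 (valuations u v) X) :
    X = relations G u v 4 := by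
  refine h.eq (fun ρ hρ Y hY hf => ?_) fun hc t ht => ?_
  · obtain ⟨⟨h1, h2⟩, h3, h4⟩ := (fires_sameDistRule hρ).1 hf
    exact ⟨h1, h3, h2.trans h4.symm⟩
  · obtain ⟨h1, h2, h3⟩ := ht
    have := hc _ (valuation_mem u v (t 0) (t 1) ⟨_, fin_dist_lt h1⟩ u (t 2) (t 3) (t 4) u)
      ((fires_sameDistRule (valuation_mem ..)).2 ⟨⟨h1, rfl⟩, h2, h3.symm⟩)
    rw [sameDistRule, fact_mk] at this
    rw [← vec5_eta t]
    exact this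

theorem fires_ltDistRule (hρ : ρ ∈ valuations u v) :
    ltDistRule.Fires (stage (relations G u v) 5) 5 Y ρ ↔
      (G.Reachable u (ρ 3) ∧ G.dist u (ρ 3) = ρ 5) ∧
      (G.Reachable u (ρ 4) ∧ G.dist u (ρ 4) = ρ 6) ∧ (ρ 5 : ℕ) < ρ 6 := by
  have hA : ∀ j < 5, Function.update (stage (relations G u v) 5) 5 Y j = relations G u v j :=
    fun j => update_stage_of_lt
  simp only [Fires, ltDistRule, Holds, holds_dist (hA 1 (by omega)) (hA 2 (by omega)), hρ.1,
    hρ.2.2, add_zero]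

theorem ltDistRule_derives
    (h : ltDistRule.Derives (stage (relations G u v) 5) 5 (valuations u v) X) :
    X = relations G u v 5 := by
  refine h.eq (fun ρ hρ Y hY hf => ?_) fun hc t ht => ?_
  · obtain ⟨⟨h1, h2⟩, ⟨h3, h4⟩, h5⟩ := (fires_ltDistRule hρ).1 hf
    exact ⟨h1, h3, by rw [← h2, ← h4] at h5; exact h5⟩
  · obtain ⟨h1, h2, h3⟩ := ht
    have := hc _ (valuation_mem u v (t 0) (t 1) ⟨_, fin_dist_lt h1⟩ ⟨_, fin_dist_lt h2⟩ (t 2) (t 3)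
      (t 4) u) ((fires_ltDistRule (valuation_mem ..)).2 ⟨⟨h1, rfl⟩, ⟨h2, rfl⟩, h3⟩)
    rw [ltDistRule, fact_mk] at this
    rw [← vec5_eta t]
    exact this

theorem fires_turnRule (hρ : ρ ∈ valuations u v) :
    turnRule.Fires (stage (relations G u v) 6) 6 Y ρ ↔
      (G.Reachable u (ρ 3) ∧ G.dist u (ρ 3) = ρ 5) ∧
      (G.Reachable v (ρ 4) ∧ G.dist v (ρ 4) = ρ 6) ∧
      (G.Reachable u v ∧ G.dist u v = ρ 7) ∧ (ρ 7 : ℕ) < ρ 5 + ρ 6 + 1 := by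
  have hA : ∀ j < 6, Function.update (stage (relations G u v) 6) 6 Y j = relations G u v j :=
    fun j => update_stage_of_lt
  simp only [Fires, turnRule, Holds, holds_dist (hA 1 (by omega)) (hA 2 (by omega)), hρ.1, hρ.2.1]

theorem turnRule_derives (h : turnRule.Derives (stage (relations G u v) 6) 6 (valuations u v) X) :
    X = relations G u v 6 := by
  refine h.eq (fun ρ hρ Y hY hf => ?_) fun hc t ht => ?_
  · obtain ⟨⟨h1, h2⟩, ⟨h3, h4⟩, ⟨h5, h6⟩, h7⟩ := (fires_turnRule hρ).1 hf
    exact ⟨h1, h3, h5, by rw [← h2, ← h4, ← h6] at h7; exact h7⟩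
  · obtain ⟨h1, h2, h3, h4⟩ := ht
    have := hc _ (valuation_mem u v (t 0) (t 1) ⟨_, fin_dist_lt h1⟩ ⟨_, fin_dist_lt h2⟩
      ⟨_, fin_dist_lt h3⟩ (t 2) (t 3) (t 4))
      ((fires_turnRule (valuation_mem ..)).2 ⟨⟨h1, rfl⟩, ⟨h2, rfl⟩, ⟨h3, rfl⟩, h4⟩)
    rw [turnRule, fact_mk] at this
    rw [← vec5_eta t]
    exact this

theorem fires_pairFwdRule (hρ : ρ ∈ valuations u v) :
    pairFwdRule.Fires (stage (relations G u v) 7) 7 Y ρ ↔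
      ((G.Apart (ρ 3) (ρ 4) u (ρ 5) ∧ G.LtDist u u (ρ 5)) ∧ ρ 8 = u ∧ ρ 9 = ρ 5 ∨
        ![ρ 3, ρ 4, ρ 5, ρ 6, ρ 7] ∈ Y ∧
          G.PairStep u (ρ 3) (ρ 4) (ρ 5) (ρ 6, ρ 7) (ρ 8, ρ 9)) := by
  have hA : ∀ j < 7, Function.update (stage (relations G u v) 7) 7 Y j = relations G u v j :=
    fun j => update_stage_of_lt
  simp only [Fires, pairFwdRule, Holds, holds_apart hρ (hA 0 (by omega)), holds_eq hρ, comp_vec5,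
    holds_ltDist (hA 5 (by omega)), holds_pairStep hρ fun j hj => hA j (by omega),
    Function.update_self, hρ.1]

theorem pairFwdRule_derives
    (h : pairFwdRule.Derives (stage (relations G u v) 7) 7 (valuations u v) X) :
    X = relations G u v 7 := by
  refine h.eq (fun ρ hρ Y hY hf => ?_) fun hc t ht => ?_
  · change G.PairFwd u (ρ 3) (ρ 4) (ρ 5) (ρ 8) (ρ 9)
    rcases (fires_pairFwdRule hρ).1 hf with ⟨h1, h2, h3⟩ | ⟨h1, h2⟩
    · rw [h2, h3]
      exact ⟨h1, .refl⟩
    · have h3 : G.PairFwd u (ρ 3) (ρ 4) (ρ 5) (ρ 6) (ρ 7) := hY h1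
      exact ⟨h3.1, h3.2.tail h2⟩
  · obtain ⟨h1, h2⟩ := ht
    have key : ∀ s, ReflTransGen (G.PairStep u (t 0) (t 1) (t 2)) (u, t 2) s →
        ![t 0, t 1, t 2, s.1, s.2] ∈ X := by
      intro s hs
      induction hs with
      | refl =>
        have := hc _ (valuation_mem u v (t 0) (t 1) (t 2) u u u (t 2) u)
          ((fires_pairFwdRule (valuation_mem ..)).2 (.inl ⟨h1, rfl, rfl⟩))
        rw [pairFwdRule, fact_mk] at this
        exact this
      | @tail s s' _ hss ih =>
        have := hc _ (valuation_mem u v (t 0) (t 1) (t 2) s.1 s.2 s'.1 s'.2 u)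
          ((fires_pairFwdRule (valuation_mem ..)).2 (.inr ⟨ih, hss⟩))
        rw [pairFwdRule, fact_mk] at this
        exact this
    have := key _ h2
    rwa [← vec5_eta t]

theorem fires_pairMidRule (hρ : ρ ∈ valuations u v) :
    pairMidRule.Fires (stage (relations G u v) 8) 8 Y ρ ↔
      G.PairFwd u (ρ 3) (ρ 4) (ρ 5) (ρ 6) (ρ 7) ∧ (ρ 6 = ρ 3 ∧ ρ 7 = v ∨
        G.PairStep u (ρ 3) (ρ 4) (ρ 5) (ρ 6, ρ 7) (ρ 8, ρ 9) ∧
          ![ρ 3, ρ 4, ρ 5, ρ 8, ρ 9] ∈ Y) := by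
  have hA : ∀ j < 8, Function.update (stage (relations G u v) 8) 8 Y j = relations G u v j :=
    fun j => update_stage_of_lt
  simp only [Fires, pairMidRule, Holds, holds_eq hρ, comp_vec5, hA 7 (by omega),
    holds_pairStep hρ fun j hj => hA j (by omega), Function.update_self, hρ.2.1]
  rfl

theorem pairMidRule_derives
    (h : pairMidRule.Derives (stage (relations G u v) 8) 8 (valuations u v) X) :
    X = relations G u v 8 := by
  refine h.eq (fun ρ hρ Y hY hf => ?_) fun hc t ht => ?_
  · change G.PairMid u v (ρ 3) (ρ 4) (ρ 5) (ρ 6) (ρ 7)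
    obtain ⟨h1, ⟨h2, h3⟩ | ⟨h2, h3⟩⟩ := (fires_pairMidRule hρ).1 hf
    · refine ⟨h1, ?_⟩
      rw [h2, h3]
    · have h4 : G.PairMid u v (ρ 3) (ρ 4) (ρ 5) (ρ 8) (ρ 9) := hY h3
      exact ⟨h1, h4.2.head h2⟩
  · obtain ⟨h1, h2⟩ := ht
    have key : ∀ s, ReflTransGen (G.PairStep u (t 0) (t 1) (t 2)) s (t 0, v) →
        G.PairFwd u (t 0) (t 1) (t 2) s.1 s.2 → ![t 0, t 1, t 2, s.1, s.2] ∈ X := by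
      intro s hs
      induction hs using ReflTransGen.head_induction_on with
      | refl =>
        intro hF
        have := hc _ (valuation_mem u v (t 0) (t 1) (t 2) (t 0) v u u u)
          ((fires_pairMidRule (valuation_mem ..)).2 ⟨hF, .inl ⟨rfl, rfl⟩⟩)
        rw [pairMidRule, fact_mk] at this
        exact this
      | @head s s' hss _ ih =>
        intro hF
        have := hc _ (valuation_mem u v (t 0) (t 1) (t 2) s.1 s.2 s'.1 s'.2 u)
          ((fires_pairMidRule (valuation_mem ..)).2
            ⟨hF, .inr ⟨hss, ih ⟨hF.1, hF.2.tail hss⟩⟩⟩)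
        rw [pairMidRule, fact_mk] at this
        exact this
    have := key _ h2 h1
    rwa [← vec5_eta t]

theorem fires_blockedRule (hρ : ρ ∈ valuations u v) :
    blockedRule.Fires (stage (relations G u v) 9) 9 Y ρ ↔
      G.PairMid u v (ρ 3) (ρ 4) (ρ 5) (ρ 6) (ρ 7) ∧ ρ 6 ≠ ρ 3 ∧
        (ρ 8 = ρ 6 ∨ G.Adj (ρ 8) (ρ 6)) := by
  have hA : ∀ j < 9, Function.update (stage (relations G u v) 9) 9 Y j = relations G u v j :=
    fun j => update_stage_of_lt
  simp only [Fires, blockedRule, Holds, holds_eq hρ, comp_vec5, hA 8 (by omega),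
    holds_edge hρ (hA 0 (by omega))]
  rfl

theorem blockedRule_derives
    (h : blockedRule.Derives (stage (relations G u v) 9) 9 (valuations u v) X) :
    X = relations G u v 9 := by
  refine h.eq (fun ρ hρ Y hY hf => ?_) fun hc t ht => ?_
  · exact ⟨ρ 6, ρ 7, (fires_blockedRule hρ).1 hf⟩
  · obtain ⟨x, y, hxy⟩ := ht
    have := hc _ (valuation_mem u v (t 0) (t 1) (t 2) x y (t 3) (t 4) u)
      ((fires_blockedRule (valuation_mem ..)).2 hxy)
    rw [blockedRule, fact_mk] at this
    rw [← vec5_eta t]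
    exact this

theorem fires_linkRule (hρ : ρ ∈ valuations u v) :
    linkRule.Fires (stage (relations G u v) 10) 10 Y ρ ↔
      ¬ G.Blocked u v (ρ 3) (ρ 4) (ρ 5) (ρ 7) ∧
        (G.PairFwd u (ρ 3) (ρ 4) (ρ 5) (ρ 3) v ∧ G.Adj (ρ 3) (ρ 7) ∧ G.Turn u v (ρ 3) (ρ 7) ∨
          ![ρ 3, ρ 4, ρ 5, ρ 6, ρ 2] ∈ Y ∧ G.Adj (ρ 6) (ρ 7) ∧ ¬ G.Adj (ρ 7) (ρ 3) ∧
            ρ 7 ≠ ρ 3) := by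
  have hA : ∀ j < 10, Function.update (stage (relations G u v) 10) 10 Y j = relations G u v j :=
    fun j => update_stage_of_lt
  simp only [Fires, linkRule, Holds, holds_eq hρ, comp_vec5, hA 9 (by omega), hA 7 (by omega),
    hA 6 (by omega), holds_edge hρ (hA 0 (by omega)), Function.update_self, hρ.2.1]
  rfl

theorem linkRule_derives (h : linkRule.Derives (stage (relations G u v) 10) 10 (valuations u v) X) :
    X = relations G u v 10 := by
  refine h.eq (fun ρ hρ Y hY hf => ?_) fun hc t ht => ?_
  · change G.Link u v (ρ 3) (ρ 4) (ρ 5) (ρ 7)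
    obtain ⟨h1, h2 | ⟨h2, h3⟩⟩ := (fires_linkRule hρ).1 hf
    · exact ⟨ρ 7, ⟨h1, h2⟩, .refl⟩
    · obtain ⟨c, h4, h5⟩ : G.Link u v (ρ 3) (ρ 4) (ρ 5) (ρ 6) := hY h2
      exact ⟨c, h4, h5.tail ⟨h1, h3⟩⟩
  · obtain ⟨c, h1, h2⟩ := ht
    have key : ∀ z, ReflTransGen (G.LinkStep u v (t 0) (t 1) (t 2)) c z → ∀ p,
        ![t 0, t 1, t 2, z, p] ∈ X := by
      intro z hz
      induction hz with
      | refl =>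
        intro p
        have := hc _ (valuation_mem u v (t 0) (t 1) (t 2) u c p u u)
          ((fires_linkRule (valuation_mem ..)).2 ⟨h1.1, .inl h1.2⟩)
        rw [linkRule, fact_mk] at this
        exact this
      | @tail z z' _ hzz ih =>
        intro p
        have := hc _ (valuation_mem u v (t 0) (t 1) (t 2) z z' p u u)
          ((fires_linkRule (valuation_mem ..)).2 ⟨hzz.1, .inr ⟨ih _, hzz.2⟩⟩)
        rw [linkRule, fact_mk] at this
        exact this
    have := key _ h2 (t 4)
    rwa [← vec5_eta t]

theorem fires_detourRule (hρ : ρ ∈ valuations u v) :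
    detourRule.Fires (stage (relations G u v) 11) 11 Y ρ ↔
      G.Link u v (ρ 3) (ρ 4) (ρ 5) (ρ 4) ∧ (ρ 4 = ρ 5 ∨ G.Adj (ρ 4) (ρ 5)) := by
  have hA : ∀ j < 11, Function.update (stage (relations G u v) 11) 11 Y j = relations G u v j :=
    fun j => update_stage_of_lt
  simp only [Fires, detourRule, Holds, holds_eq hρ, comp_vec5, hA 10 (by omega),
    holds_edge hρ (hA 0 (by omega))]
  rfl

theorem detourRule_derives
    (h : detourRule.Derives (stage (relations G u v) 11) 11 (valuations u v) X) :
    X = relations G u v 11 := by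
  refine h.eq (fun ρ hρ Y hY hf => ?_) fun hc t ht => ?_
  · exact ⟨ρ 3, ρ 4, ρ 5, (fires_detourRule hρ).1 hf⟩
  · obtain ⟨a, b, b', h1⟩ := ht
    have := hc _ (valuation_mem u v a b b' (t 0) (t 1) (t 2) (t 3) (t 4))
      ((fires_detourRule (valuation_mem ..)).2 h1)
    rw [detourRule, fact_mk] at this
    rw [← vec5_eta t]
    exact this

theorem rules_define (G : SimpleGraph (Fin n)) (u v : Fin n) :
    Define (relations G u v) (valuations u v) 1 rules :=
  ⟨fun _ => walkRule_derives, fun _ => shorterWalkRule_derives, fun _ => upRule_derives,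
    fun _ => sameDistRule_derives, fun _ => ltDistRule_derives, fun _ => turnRule_derives,
    fun _ => pairFwdRule_derives, fun _ => pairMidRule_derives, fun _ => blockedRule_derives,
    fun _ => linkRule_derives, fun _ => detourRule_derives, trivial⟩

/-- The input adjacency matrix is already the table of relation 0, so no preprocessing is needed. -/
theorem rep_inputState (G : SimpleGraph (Fin n)) (u v : Fin n) :
    ∃ ρ ∈ valuations u v, Rep (inputState G u v) (stage (relations G u v) 1) ρ := by
  have hn : 0 < n := (Nat.zero_le _).trans_lt u.2
  let z : Fin n := ⟨0, hn⟩
  have hcode : ∀ (k : ℕ) (t : Fin 5 → Fin n), t ∈ stage (relations G u v) 1 k ↔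
      ∃ i j : Fin n, code n k t = n * i + j ∧ G.Adj i j := by
    have h0 : ∀ i j : Fin n, code n 0 ![z, z, z, i, j] = n * i + j := fun i j => by
      simp [code, z, mul_comm]
    intro k t
    constructor
    · intro ht
      obtain rfl : k = 0 := by
        by_contra hk
        simp [stage, hk] at ht
      obtain ⟨⟨h1, h2, h3⟩, h4⟩ := ht
      exact ⟨t 3, t 4, by simp [code, h1, h2, h3, mul_comm], h4⟩
    · rintro ⟨i, j, h, hij⟩
      rw [← h0] at h
      obtain ⟨rfl, rfl⟩ := code_inj h
      exact ⟨⟨rfl, rfl, rfl⟩, hij⟩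
  refine ⟨_, valuation_mem u v z z z z z z z z, rfl, ?_, fun k t ht => ?_, fun k t ht => ?_⟩
  · intro j
    fin_cases j <;> rfl
  · exact if_pos ((hcode k t).1 ht)
  · exact if_neg fun h => ht ((hcode k t).2 h)

end WordRAM

/-! ### The complete program. -/

theorem theorem1p1 :
    ∃ (P : WordRAM.Prog) (C k : ℕ), ∀ (n : ℕ) (G : SimpleGraph (Fin n)) (u v : Fin n),
      ∃ (t : ℕ) (s : WordRAM.State),
        WordRAM.Exec (C * n ^ k) P (WordRAM.inputState G u v) t s ∧
        t ≤ C * n ^ 16 ∧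
        (G.HasNSP u v → s.reg 0 = 1) ∧
        (¬ G.HasNSP u v → s.reg 0 = 0) := by
  -- Relation 11 does not depend on its tuple, so the cell of the zero tuple holds the answer.
  refine ⟨.seq (WordRAM.runRules 1 WordRAM.rules) (.seq (WordRAM.addr 11 fun _ => 2) (.load 0 12)),
    -- The first summand bounds the words and the second the time; 12 covers both the addresses of
    -- relation 11, below `12 * n ^ 5`, and the last 12 steps.
    WordRAM.rulesSize 1 WordRAM.rules + WordRAM.rulesCost WordRAM.rules + 12, 5,
    fun n G u v => ?_⟩
  have hn : 0 < n := (Nat.zero_le _).trans_lt u.2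
  obtain ⟨ρ, hρ, hs⟩ := WordRAM.rep_inputState G u v
  obtain ⟨t, s, ρ', e, ht, -, hs'⟩ := WordRAM.exec_runRules
    (W := (WordRAM.rulesSize 1 WordRAM.rules + WordRAM.rulesCost WordRAM.rules + 12) * n ^ 5)
    WordRAM.rules 1 _ ρ (Nat.mul_le_mul_right _ (by omega)) (WordRAM.rules_define G u v) hρ hs
  have e' := WordRAM.exec_addr hs' (k := 11) (fun _ => 2) (Nat.mul_le_mul_right (n ^ 5)
    (show 11 + 1 ≤ WordRAM.rulesSize 1 WordRAM.rules + WordRAM.rulesCost WordRAM.rules + 12 by omega))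
  refine ⟨_, _, .seq e (.seq e' (.load _ 0 12)), ?_, fun h => ?_, fun h => ?_⟩
  · have h1 : n ^ 13 ≤ n ^ 16 := Nat.pow_le_pow_right hn (by omega)
    have h2 : 1 ≤ n ^ 16 := Nat.pow_pos hn
    nlinarith [Nat.mul_le_mul_right (WordRAM.rulesCost WordRAM.rules) h1,
      Nat.zero_le (WordRAM.rulesSize 1 WordRAM.rules * n ^ 16)]
  · rw [WordRAM.setReg_reg_self, WordRAM.setReg_reg_self]
    exact hs'.mem_of_mem 11 _ (SimpleGraph.hasNSP_iff_hasDetour.1 h)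
  · rw [WordRAM.setReg_reg_self, WordRAM.setReg_reg_self]
    exact hs'.mem_of_not_mem 11 _ fun h' => h (SimpleGraph.hasNSP_iff_hasDetour.2 h')
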